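/- Let $\mathbb F$ be an algebraically closed field of characteristic zero. Let $\mathcal W=\mathcal W(\mathbb Z,1)$ be the Lie algebra with basis $\{t^\alpha D^\mu : \alpha\in\mathbb Z,\ \mu\in\mathbb Z_{\ge 0}\}$ whose bracket is the commutator of the associative product $$(t^\alpha D^\mu)\cdot(t^\beta D^\nu)=\sum_{\lambda=0}^{\mu}\binom{\mu}{\lambda}\beta^\lambda\, t^{\alpha+\beta}D^{\mu+\nu-\lambda},$$ graded by $\mathcal W_\alpha=\mathrm{span}\{t^\alpha D^\mu:\mu\ge 0\}$. A $\mathcal W$-module is called uniformly bounded if it is $\mathbb Z$-graded, $V=\bigoplus_{k\in\mathbb Z}V_k$ with $\mathcal W_\alpha V_\beta\subseteq V_{\alpha+\beta}$, and there is a positive integer $N$ with $\dim V_k\le N$ for all $k$. It is called indecomposable if it is nonzero and is not the direct sum of two nonzero graded submodules. A trivial composition factor of $V$ is an irreducible quotient $M/M'$ of graded submodules $M'\subset M\subseteq V$ on which $\mathcal W$ acts by zero. For $p\ge1$ and a $p\times p$ matrix $G$ over $\mathbb F$, let $A_{p,G}$ and $\overline A_{p,G}$ be the graded $\mathcal W$-modules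 with basis $\{y_\beta^{(i)}:\beta\in\mathbb Z,\ 1\le i\le p\}$, with $y_\beta^{(i)}$ of degree $\beta$, and with action, writing $Y_\beta=(y_\beta^{(1)},\dots,y_\beta^{(p)})$ and $\mathbf 1_p$ for the identity matrix, $$(t^\alpha D^\mu)Y_\beta=Y_{\alpha+\beta}(\beta\mathbf 1_p+G)^\mu\quad\text{on }A_{p,G},$$ $$(t^\alpha D^\mu)Y_\beta=(-1)^{\mu+1}Y_{\alpha+\beta}\bigl((\alpha+\beta)\mathbf 1_p+G\bigr)^\mu\quad\text{on }\overline A_{p,G}.$$ **Proposition.** Let $V$ be an indecomposable uniformly bounded $\mathcal W$-module without trivial composition factor. Then there are $p\ge 1$ and a $p\times p$ matrix $G$ over $\mathbb F$ such that $V$ is isomorphic, as a graded $\mathcal W$-module, to $A_{p,G}$ or to $\overline A_{p,G}$. -/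

import Mathlib

open Polynomial

noncomputable section

namespace WeylType

/-! ### The Weyl algebra of rank one on the group `ℤ` -/

/-- The vector space `F[ℤ] ⊗ F[D]`: the element `Finsupp.single α f` stands for `t ^ α f(D)`. -/
def W (F : Type*) [Field F] : Type _ := ℤ →₀ F[X]

section WeylAlgebra

variable {F : Type*} [Field F]

instance : AddCommGroup (W F) := inferInstanceAs (AddCommGroup (ℤ →₀ F[X]))
instance : Module F (W F) := inferInstanceAs (Module F (ℤ →₀ F[X]))

/-- The element `t ^ α f(D)`, linear in `f`. -/
def W.tf (α : ℤ) : F[X] →ₗ[F] W F := Finsupp.lsingle α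

/-- The element `t ^ α D ^ μ`. -/
def W.tD (F : Type*) [Field F] (α : ℤ) (μ : ℕ) : W F := W.tf α (X ^ μ)

/-- The linear map on `W F` with prescribed values at all `t ^ α f(D)`. -/
def W.lift {M : Type*} [AddCommGroup M] [Module F M] (φ : ℤ → F[X] →ₗ[F] M) : W F →ₗ[F] M :=
  Finsupp.lsum F φ

theorem W.lift_tf {M : Type*} [AddCommGroup M] [Module F M] (φ : ℤ → F[X] →ₗ[F] M)
    (α : ℤ) (f : F[X]) : W.lift φ (W.tf α f) = φ α f :=
  Finsupp.lsum_single F φ α f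

theorem W.ext_hom {M : Type*} [AddCommMonoid M] [Module F M] {φ ψ : W F →ₗ[F] M}
    (h : ∀ α f, φ (W.tf α f) = ψ (W.tf α f)) : φ = ψ :=
  Finsupp.lhom_ext h

/-- The associative product, `(t ^ α f(D)) (t ^ β g(D)) = t ^ (α + β) f(D + β) g(D)`;
`W.tD_mul_tD` below gives it on the basis `t ^ α D ^ μ`. -/
def W.mulHom : W F →ₗ[F] W F →ₗ[F] W F :=
  W.lift fun α =>
    { toFun := fun f => W.lift fun β =>
        (W.tf (α + β)).comp (LinearMap.mulLeft F (taylor (β : F) f))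
      map_add' := fun f g => by
        refine W.ext_hom fun β h => ?_
        simp [W.lift_tf, add_mul]
      map_smul' := fun c f => by
        refine W.ext_hom fun β h => ?_
        simp [W.lift_tf] }

theorem W.mulHom_tf (α β : ℤ) (f g : F[X]) :
    W.mulHom (W.tf α f) (W.tf β g) = W.tf (α + β) (taylor (β : F) f * g) := by
  simp [W.mulHom, W.lift_tf]

theorem W.mulHom_assoc (x y z : W F) :
    W.mulHom (W.mulHom x y) z = W.mulHom x (W.mulHom y z) := by
  have key : (W.mulHom (F := F)).compr₂ W.mulHom =
      (LinearMap.lcomp F (W F →ₗ[F] W F) (W.mulHom (F := F))).comp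
        ((LinearMap.llcomp F (W F) (W F) (W F)).comp W.mulHom) := by
    refine W.ext_hom fun α f => W.ext_hom fun β g => W.ext_hom fun γ h => ?_
    simp only [LinearMap.compr₂_apply, LinearMap.comp_apply, LinearMap.lcomp_apply,
      LinearMap.llcomp_apply, W.mulHom_tf]
    rw [taylor_mul, taylor_taylor, add_assoc, mul_assoc]
    push_cast
    rw [add_comm (γ : F)]
  exact LinearMap.congr_fun (LinearMap.congr_fun (LinearMap.congr_fun key x) y) z

instance : Mul (W F) := ⟨fun x y => W.mulHom x y⟩
instance : One (W F) := ⟨W.tf 0 1⟩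

theorem W.tf_mul_tf (α β : ℤ) (f g : F[X]) :
    W.tf α f * W.tf β g = W.tf (α + β) (taylor (β : F) f * g) :=
  W.mulHom_tf α β f g

theorem W.one_mul' (x : W F) : 1 * x = x := by
  have key : W.mulHom (W.tf 0 (1 : F[X])) = LinearMap.id := by
    refine W.ext_hom fun α f => ?_
    simp [W.mulHom_tf]
  exact LinearMap.congr_fun key x

theorem W.mul_one' (x : W F) : x * 1 = x := by
  have key : W.mulHom.flip (W.tf 0 (1 : F[X])) = LinearMap.id := by
    refine W.ext_hom fun α f => ?_
    simp [W.mulHom_tf]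
  exact LinearMap.congr_fun key x

instance : Ring (W F) :=
  { (inferInstance : AddCommGroup (W F)) with
    mul := (· * ·)
    one := 1
    left_distrib := fun x y z => map_add (W.mulHom x) y z
    right_distrib := fun x y z => LinearMap.map_add₂ W.mulHom x y z
    zero_mul := fun x => LinearMap.map_zero₂ W.mulHom x
    mul_zero := fun x => map_zero (W.mulHom x)
    mul_assoc := W.mulHom_assoc
    one_mul := W.one_mul'
    mul_one := W.mul_one' }

instance : Algebra F (W F) :=
  Algebra.ofModule (fun c x y => LinearMap.map_smul₂ W.mulHom c x y)
    (fun c x y => map_smul (W.mulHom x) c y)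

/-- The product on the basis:
`(t ^ α D ^ μ) (t ^ β D ^ ν) = ∑ λ, (μ choose λ) β ^ λ t ^ (α + β) D ^ (μ + ν - λ)`. -/
theorem W.tD_mul_tD (α β : ℤ) (μ ν : ℕ) :
    W.tD F α μ * W.tD F β ν = ∑ l ∈ Finset.range (μ + 1),
      ((μ.choose l : F) * (β : F) ^ l) • W.tD F (α + β) (μ + ν - l) := by
  simp only [W.tD, W.tf_mul_tf, ← map_smul, ← map_sum]
  congr 1
  rw [taylor_X_pow, add_comm, add_pow, Finset.sum_mul]
  refine Finset.sum_congr rfl fun l hl => ?_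
  have hl' : l ≤ μ := Nat.lt_succ_iff.mp (Finset.mem_range.mp hl)
  rw [show μ + ν - l = (μ - l) + ν by omega, pow_add, smul_eq_C_mul]
  simp only [map_mul, map_pow, map_natCast]
  ring

/-- The Lie algebra `𝒲(ℤ, 1)`: the commutator bracket of the associative product. -/
instance : LieRing (W F) := LieRing.ofAssociativeRing
instance : LieAlgebra F (W F) := LieAlgebra.ofAssociativeAlgebra

theorem W.lie_def (x y : W F) : ⁅x, y⁆ = x * y - y * x := rfl

/-- The grading space `𝒲_α`, spanned by the `t ^ α D ^ μ` with `μ ≥ 0`. -/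
def W.grade (F : Type*) [Field F] (α : ℤ) : Submodule F (W F) :=
  Submodule.span F (Set.range (W.tD F α))

end WeylAlgebra

/-! ### The modules `A_{p,G}` and their twists -/

/-- The vector space with basis `y_β ^ (i)` (`β ∈ ℤ`, `i < p`): the element `Finsupp.single β v`
stands for `Y_β v = ∑ i, v_i y_β ^ (i)`, where `Y_β = (y_β ^ (1), …, y_β ^ (p))`. -/
def YSpace (F : Type*) [Field F] (p : ℕ) : Type _ := ℤ →₀ (Fin p → F)

section Modules

variable {F : Type*} [Field F] {p : ℕ}

instance : AddCommGroup (YSpace F p) := inferInstanceAs (AddCommGroup (ℤ →₀ (Fin p → F)))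
instance : Module F (YSpace F p) := inferInstanceAs (Module F (ℤ →₀ (Fin p → F)))

/-- The element `Y_β v`, linear in the column vector `v`. -/
def YSpace.Y (β : ℤ) : (Fin p → F) →ₗ[F] YSpace F p := Finsupp.lsingle β

/-- The linear map on `YSpace F p` with prescribed values at all `Y_β v`. -/
def YSpace.lift {M : Type*} [AddCommGroup M] [Module F M] (φ : ℤ → (Fin p → F) →ₗ[F] M) :
    YSpace F p →ₗ[F] M :=
  Finsupp.lsum F φ

theorem YSpace.lift_Y {M : Type*} [AddCommGroup M] [Module F M]
    (φ : ℤ → (Fin p → F) →ₗ[F] M) (β : ℤ) (v : Fin p → F) :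
    YSpace.lift φ (YSpace.Y β v) = φ β v :=
  Finsupp.lsum_single F φ β v

theorem YSpace.ext_hom {M : Type*} [AddCommMonoid M] [Module F M] {φ ψ : YSpace F p →ₗ[F] M}
    (h : ∀ β v, φ (YSpace.Y β v) = ψ (YSpace.Y β v)) : φ = ψ :=
  Finsupp.lhom_ext h

/-- The action on `A_{p,G}`: `(t ^ α f(D)) Y_β = Y_{α + β} f(β + G)`. -/
def actA (G : Matrix (Fin p) (Fin p) F) : W F →ₗ[F] Module.End F (YSpace F p) :=
  W.lift fun α =>
    { toFun := fun f => YSpace.lift fun β => (YSpace.Y (α + β)).comp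
        (aeval ((β : F) • (1 : Matrix (Fin p) (Fin p) F) + G) f).mulVecLin
      map_add' := fun f g => by
        refine YSpace.ext_hom fun β v => ?_
        simp [YSpace.lift_Y]
      map_smul' := fun c f => by
        refine YSpace.ext_hom fun β v => ?_
        simp [YSpace.lift_Y] }

theorem actA_tf (G : Matrix (Fin p) (Fin p) F) (α β : ℤ) (f : F[X]) (v : Fin p → F) :
    actA G (W.tf α f) (YSpace.Y β v) = YSpace.Y (α + β)
      ((aeval ((β : F) • (1 : Matrix (Fin p) (Fin p) F) + G) f).mulVec v) := by
  simp [actA, W.lift_tf, YSpace.lift_Y]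

theorem actA_tD (G : Matrix (Fin p) (Fin p) F) (α β : ℤ) (μ : ℕ) (v : Fin p → F) :
    actA G (W.tD F α μ) (YSpace.Y β v) = YSpace.Y (α + β)
      ((((β : F) • (1 : Matrix (Fin p) (Fin p) F) + G) ^ μ).mulVec v) := by
  simp [W.tD, actA_tf]

/-- The action on the twist of `A_{p,G}`: `(t ^ α f(D)) Y_β = -Y_{α + β} f(-(α + β + G))`. -/
def actB (G : Matrix (Fin p) (Fin p) F) : W F →ₗ[F] Module.End F (YSpace F p) :=
  W.lift fun α =>
    { toFun := fun f => YSpace.lift fun β => -((YSpace.Y (α + β)).comp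
        (aeval (-(((α + β : ℤ) : F) • (1 : Matrix (Fin p) (Fin p) F) + G)) f).mulVecLin)
      map_add' := fun f g => by
        refine YSpace.ext_hom fun β v => ?_
        simp [YSpace.lift_Y, add_comm]
      map_smul' := fun c f => by
        refine YSpace.ext_hom fun β v => ?_
        simp [YSpace.lift_Y] }

theorem actB_tf (G : Matrix (Fin p) (Fin p) F) (α β : ℤ) (f : F[X]) (v : Fin p → F) :
    actB G (W.tf α f) (YSpace.Y β v) = -YSpace.Y (α + β)
      ((aeval (-(((α + β : ℤ) : F) • (1 : Matrix (Fin p) (Fin p) F) + G)) f).mulVec v) := by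
  simp [actB, W.lift_tf, YSpace.lift_Y]

theorem actB_tD (G : Matrix (Fin p) (Fin p) F) (α β : ℤ) (μ : ℕ) (v : Fin p → F) :
    actB G (W.tD F α μ) (YSpace.Y β v) = (-1 : F) ^ (μ + 1) • YSpace.Y (α + β)
      (((((α + β : ℤ) : F) • (1 : Matrix (Fin p) (Fin p) F) + G) ^ μ).mulVec v) := by
  rw [W.tD, actB_tf, map_pow, aeval_X, neg_pow, ← map_smul, ← map_neg, pow_succ]
  congr 1
  rcases Nat.even_or_odd μ with h | h <;> simp [h.neg_one_pow, Matrix.neg_mulVec]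

theorem aeval_taylor (r : F) (M : Matrix (Fin p) (Fin p) F) (f : F[X]) :
    aeval M (taylor r f) = aeval (r • (1 : Matrix (Fin p) (Fin p) F) + M) f := by
  rw [taylor_apply, aeval_comp]
  congr 2
  simp [Algebra.algebraMap_eq_smul_one, add_comm]

theorem actA_mul (G : Matrix (Fin p) (Fin p) F) (x y : W F) :
    actA G (x * y) = actA G x * actA G y := by
  have key : (W.mulHom (F := F)).compr₂ (actA G) =
      ((LinearMap.mul F (Module.End F (YSpace F p))).compl₁₂ (actA G) (actA G)) := by
    refine W.ext_hom fun α f => W.ext_hom fun β g => YSpace.ext_hom fun γ v => ?_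
    simp only [LinearMap.compr₂_apply, LinearMap.compl₁₂_apply, LinearMap.mul_apply',
      W.mulHom_tf, Module.End.mul_apply, actA_tf, map_mul, aeval_taylor, Matrix.mulVec_mulVec]
    rw [← add_assoc α β γ, ← add_assoc (((β : ℤ) : F) • _) _ G, ← add_smul, ← Int.cast_add]
  exact LinearMap.congr_fun (LinearMap.congr_fun key x) y

theorem actB_mul (G : Matrix (Fin p) (Fin p) F) (x y : W F) :
    actB G (x * y) = -(actB G y * actB G x) := by
  have key : (W.mulHom (F := F)).compr₂ (actB G) =
      -((LinearMap.mul F (Module.End F (YSpace F p))).flip.compl₁₂ (actB G) (actB G)) := by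
    refine W.ext_hom fun α f => W.ext_hom fun β g => YSpace.ext_hom fun γ v => ?_
    simp only [LinearMap.compr₂_apply, LinearMap.compl₁₂_apply, LinearMap.mul_apply',
      LinearMap.flip_apply, LinearMap.neg_apply, map_neg, neg_neg,
      W.mulHom_tf, Module.End.mul_apply, actB_tf, mul_comm _ g, map_mul, aeval_taylor,
      Matrix.mulVec_mulVec]
    rw [show β + (α + γ) = α + β + γ by ring,
      show (β : F) • (1 : Matrix (Fin p) (Fin p) F) + -(((α + β + γ : ℤ) : F) • 1 + G) =
        -(((α + γ : ℤ) : F) • 1 + G) by push_cast; module]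
  exact LinearMap.congr_fun (LinearMap.congr_fun key x) y

theorem actA_lie (G : Matrix (Fin p) (Fin p) F) (x y : W F) (m : YSpace F p) :
    actA G x (actA G y m) = actA G ⁅x, y⁆ m + actA G y (actA G x m) := by
  rw [W.lie_def, map_sub, actA_mul, actA_mul, LinearMap.sub_apply, Module.End.mul_apply,
    Module.End.mul_apply, sub_add_cancel]

theorem actB_lie (G : Matrix (Fin p) (Fin p) F) (x y : W F) (m : YSpace F p) :
    actB G x (actB G y m) = actB G ⁅x, y⁆ m + actB G y (actB G x m) := by
  rw [W.lie_def, map_sub, actB_mul, actB_mul, neg_sub_neg, LinearMap.sub_apply,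
    Module.End.mul_apply, Module.End.mul_apply, sub_add_cancel]

/-- The underlying space of the module `A_{p,G}`. -/
def AMod (_G : Matrix (Fin p) (Fin p) F) : Type _ := YSpace F p

/-- The underlying space of the twisted module of `A_{p,G}`. -/
def ABarMod (_G : Matrix (Fin p) (Fin p) F) : Type _ := YSpace F p

variable (G : Matrix (Fin p) (Fin p) F)

instance : AddCommGroup (AMod G) := inferInstanceAs (AddCommGroup (YSpace F p))
instance : Module F (AMod G) := inferInstanceAs (Module F (YSpace F p))
instance : AddCommGroup (ABarMod G) := inferInstanceAs (AddCommGroup (YSpace F p))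
instance : Module F (ABarMod G) := inferInstanceAs (Module F (YSpace F p))

/-- The module `A_{p,G}`. -/
instance : LieRingModule (W F) (AMod G) where
  bracket x m := actA G x m
  add_lie x y m := LinearMap.map_add₂ (actA G) x y m
  lie_add x m n := map_add (actA G x) m n
  leibniz_lie x y m := actA_lie G x y m

instance : LieModule F (W F) (AMod G) where
  smul_lie c x m := LinearMap.map_smul₂ (actA G) c x m
  lie_smul c x m := map_smul (actA G x) c m

/-- The twisted module of `A_{p,G}`. -/
instance : LieRingModule (W F) (ABarMod G) where
  bracket x m := actB G x m
  add_lie x y m := LinearMap.map_add₂ (actB G) x y m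
  lie_add x m n := map_add (actB G x) m n
  leibniz_lie x y m := actB_lie G x y m

instance : LieModule F (W F) (ABarMod G) where
  smul_lie c x m := LinearMap.map_smul₂ (actB G) c x m
  lie_smul c x m := map_smul (actB G x) c m

/-- The element `Y_β v` of `A_{p,G}`. -/
def AMod.Y (β : ℤ) : (Fin p → F) →ₗ[F] AMod G := YSpace.Y β

/-- The element `Y_β v` of the twisted module of `A_{p,G}`. -/
def ABarMod.Y (β : ℤ) : (Fin p → F) →ₗ[F] ABarMod G := YSpace.Y β

/-- The defining formula of `A_{p,G}`: `(t ^ α D ^ μ) Y_β = Y_{α + β} (β + G) ^ μ`. -/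
theorem AMod.tD_lie_Y (α β : ℤ) (μ : ℕ) (v : Fin p → F) :
    ⁅W.tD F α μ, AMod.Y G β v⁆ = AMod.Y G (α + β)
      ((((β : F) • (1 : Matrix (Fin p) (Fin p) F) + G) ^ μ).mulVec v) :=
  actA_tD G α β μ v

/-- The defining formula of the twisted module:
`(t ^ α D ^ μ) Y_β = (-1) ^ (μ + 1) Y_{α + β} (α + β + G) ^ μ`. -/
theorem ABarMod.tD_lie_Y (α β : ℤ) (μ : ℕ) (v : Fin p → F) :
    ⁅W.tD F α μ, ABarMod.Y G β v⁆ = (-1 : F) ^ (μ + 1) • ABarMod.Y G (α + β)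
      (((((α + β : ℤ) : F) • (1 : Matrix (Fin p) (Fin p) F) + G) ^ μ).mulVec v) :=
  actB_tD G α β μ v

/-- The degree `k` part of `A_{p,G}`, with basis `y_k ^ (1), …, y_k ^ (p)`. -/
def AMod.grade (k : ℤ) : Submodule F (AMod G) := LinearMap.range (AMod.Y G k)

/-- The degree `k` part of the twisted module of `A_{p,G}`. -/
def ABarMod.grade (k : ℤ) : Submodule F (ABarMod G) := LinearMap.range (ABarMod.Y G k)

end Modules

/-! ### Graded modules -/

section Graded

variable {F : Type*} [Field F] {V : Type*} [AddCommGroup V] [Module F V]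
  [LieRingModule (W F) V] [LieModule F (W F) V]

/-- `V = ⨁ V_k` is a `ℤ`-graded `𝒲`-module (`𝒲_α V_β ⊆ V_{α + β}`) with finite-dimensional
grading spaces. -/
structure IsQuasifinite (𝒱 : ℤ → Submodule F V) : Prop where
  isInternal : DirectSum.IsInternal 𝒱
  lie_mem : ∀ (α β : ℤ) (x : W F) (v : V), x ∈ W.grade F α → v ∈ 𝒱 β → ⁅x, v⁆ ∈ 𝒱 (α + β)
  finiteDimensional : ∀ k : ℤ, FiniteDimensional F (𝒱 k)

/-- A quasifinite module whose grading spaces have bounded dimension. -/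
structure IsUniformlyBounded (𝒱 : ℤ → Submodule F V) : Prop extends IsQuasifinite 𝒱 where
  bounded : ∃ N : ℕ, 0 < N ∧ ∀ k : ℤ, Module.finrank F (𝒱 k) ≤ N

/-- A submodule is graded if it is spanned by its homogeneous elements. -/
def IsGradedSubmodule (𝒱 : ℤ → Submodule F V) (M : LieSubmodule F (W F) V) : Prop :=
  M.toSubmodule = ⨆ k : ℤ, M.toSubmodule ⊓ 𝒱 k

/-- A nonzero graded module that is not the direct sum of two nonzero graded submodules. (A graded
module that is indecomposable as an ungraded module satisfies this as well.) -/
structure IsIndecomposable (𝒱 : ℤ → Submodule F V) : Prop where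
  nontrivial : Nontrivial V
  eq_bot_or_eq_bot : ∀ M M' : LieSubmodule F (W F) V,
    IsGradedSubmodule 𝒱 M → IsGradedSubmodule 𝒱 M' → IsCompl M M' → M = ⊥ ∨ M' = ⊥

/-- Some composition factor `M / M'` (graded submodules `M' ⊂ M` with irreducible quotient) is a
trivial module, i.e. `𝒲` acts on `M / M'` by zero. -/
def HasTrivialCompositionFactor (𝒱 : ℤ → Submodule F V) : Prop :=
  ∃ M' M : LieSubmodule F (W F) V, IsGradedSubmodule 𝒱 M' ∧ IsGradedSubmodule 𝒱 M ∧ M' ⋖ M ∧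
    ∀ (x : W F), ∀ v ∈ M, ⁅x, v⁆ ∈ M'

/-- Isomorphism of graded `𝒲`-modules. -/
def GradedIso {V' : Type*} [AddCommGroup V'] [Module F V'] [LieRingModule (W F) V']
    [LieModule F (W F) V'] (𝒱 : ℤ → Submodule F V) (𝒱' : ℤ → Submodule F V') : Prop :=
  ∃ e : V ≃ₗ⁅F, W F⁆ V', ∀ k : ℤ, ∀ v : V, v ∈ 𝒱 k ↔ e v ∈ 𝒱' k

end Graded

end WeylType

end

namespace WeylType

/-! ### Difference equations and annihilators of functionals on polynomials -/

section Functionals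

variable {F : Type*} [Field F] {M : Type*} [AddCommGroup M] [Module F M]

/-! A weight of degree `k` is the functional `l` on `F[X]` recording how the commuting operators
`f(D)` act on a joint eigenvector `v`. Since `[g(D), t^α f(D)] = t^α (g(D + α) - g(D)) f(D)` and,
for `α ≠ 0`, every polynomial has the form `g(X + α) - g(X)`, the `f` with `t^α f(D) v = 0` form an
ideal. It is nonzero because degree `k + α` is finite-dimensional, and each root `y` of its
generator produces the weight `l + leval (y + α) - leval y` there.

The generators for `α` and `-α` together bound the support of `l - l ∘ taylor α`
(`exists_transition`). This forces `l` itself to have finite support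
(`exists_kills_of_forall_sub_taylor`). If `l` is neither `0` nor `± leval x`, two successive moves
with large shifts create quadratically many distinct weights in a range of degrees of linear length,
contradicting the bound `N` (`isWeight_eq_leval`).

In an indecomposable module the endomorphisms `1` and `D - deg` have a single eigenvalue each, so
one of the three types `0`, `leval (a + k)`, `-leval (-a - k)` occurs in all degrees. Type `0`
yields a trivial composition factor. The third type is a twist of the second.

For `leval (a + k)`, each `t^α f(D)` kills degree `k` once `f` is divisible by a high power of `X -
(a + k)`. Comparing such annihilators at two different points shows that the Lie action is an
associative action (`comp_eq`), with `1` acting as the identity. Then `t^k` identifies degree `0`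
with degree `k`, and `G` is the matrix of `D` in degree `0`. -/

theorem exists_taylor_sub_eq [CharZero F] {a : F} (ha : a ≠ 0) (h : F[X]) :
    ∃ g : F[X], taylor a g - g = h := by
  set R : Submodule F F[X] := LinearMap.range (taylor a - LinearMap.id) with hR
  have hpow : ∀ n : ℕ, (X ^ n : F[X]) ∈ R := by
    intro n
    induction n using Nat.strong_induction_on with
    | _ n ih =>
      have h1 : taylor a (X ^ (n + 1) : F[X]) - X ^ (n + 1) ∈ R := ⟨X ^ (n + 1), rfl⟩
      have h2 : taylor a (X ^ (n + 1) : F[X]) - X ^ (n + 1) =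
          (∑ m ∈ Finset.range n, (a ^ (n + 1 - m) * ((n + 1).choose m : F)) • X ^ m) +
            (a * (n + 1 : F)) • X ^ n := by
        rw [taylor_X_pow, add_pow, Finset.sum_range_succ, Finset.sum_range_succ]
        have h3 : ∀ m, (X : F[X]) ^ m * C a ^ (n + 1 - m) * ((n + 1).choose m : F[X]) =
            (a ^ (n + 1 - m) * ((n + 1).choose m : F)) • X ^ m := by
          intro m
          rw [smul_eq_C_mul, C_mul, C_pow, C_eq_natCast]; ring
        simp only [h3]
        simp
      have h3 : (∑ m ∈ Finset.range n,
          (a ^ (n + 1 - m) * ((n + 1).choose m : F)) • (X : F[X]) ^ m) ∈ R :=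
        R.sum_mem fun m hm => R.smul_mem _ (ih m (Finset.mem_range.mp hm))
      have h4 : (a * (n + 1 : F)) • (X : F[X]) ^ n ∈ R := by
        rw [h2] at h1
        exact (R.add_mem_iff_right h3).mp h1
      exact (R.smul_mem_iff (mul_ne_zero ha (Nat.cast_add_one_ne_zero n))).mp h4
  have hh : h ∈ R := by
    rw [h.as_sum_range_C_mul_X_pow]
    refine R.sum_mem fun i _ => ?_
    rw [← smul_eq_C_mul]
    exact R.smul_mem _ (hpow i)
  obtain ⟨g, hg⟩ := hh
  exact ⟨g, hg⟩

/-- The functional `Φ` vanishes on the multiples of `p`. -/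
def Kills (p : F[X]) (Φ : F[X] →ₗ[F] M) : Prop := ∀ h, Φ (p * h) = 0

theorem Kills.mul_left {p : F[X]} {Φ : F[X] →ₗ[F] M} (hp : Kills p Φ) (q : F[X]) :
    Kills (q * p) Φ := fun h => by rw [mul_comm q, mul_assoc]; exact hp _

theorem Kills.mul_right {p : F[X]} {Φ : F[X] →ₗ[F] M} (hp : Kills p Φ) (q : F[X]) :
    Kills (p * q) Φ := fun h => by rw [mul_assoc]; exact hp _

theorem Kills.add {p : F[X]} {Φ Ψ : F[X] →ₗ[F] M} (hp : Kills p Φ) (hq : Kills p Ψ) :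
    Kills p (Φ + Ψ) := fun h => by rw [LinearMap.add_apply, hp, hq, add_zero]

theorem Kills.sub {p : F[X]} {Φ Ψ : F[X] →ₗ[F] M} (hp : Kills p Φ) (hq : Kills p Ψ) :
    Kills p (Φ - Ψ) := fun h => by rw [LinearMap.sub_apply, hp, hq, sub_zero]

theorem Kills.eq_zero_of_isCoprime {p q : F[X]} {Φ : F[X] →ₗ[F] M} (hp : Kills p Φ)
    (hq : Kills q Φ) (hpq : IsCoprime p q) : Φ = 0 := by
  obtain ⟨a, b, hab⟩ := hpq
  ext1 n
  ext1
  simp only [LinearMap.comp_apply, LinearMap.zero_apply]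
  set h : F[X] := monomial n 1
  have : h = p * (a * h) + q * (b * h) := by linear_combination (-h) * hab
  rw [this, map_add, hp, hq, add_zero]

/-- Composing with `taylor a` turns evaluation at `z` into evaluation at `z + a`, so supports move
by `+a`, as do the roots of `taylor (-a) p`. -/
theorem Kills.comp_taylor {p : F[X]} {Φ : F[X] →ₗ[F] M} (hp : Kills p Φ) (a : F) :
    Kills (taylor (-a) p) (Φ.comp (taylor a)) := fun h => by
  rw [LinearMap.comp_apply, taylor_mul, taylor_taylor, add_neg_cancel, taylor_zero]
  exact hp _

/-- The point `z` lies in the support of `Φ`. -/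
def InSupport (z : F) (Φ : F[X] →ₗ[F] M) : Prop := ∀ q, Kills q Φ → q.eval z = 0

/-- The annihilating polynomials form an ideal; it is proper because `Φ ≠ 0`, so its generator is no
unit and has a root. A zero generator is allowed: then every point lies in the support. -/
theorem exists_inSupport [IsAlgClosed F] {Φ : F[X] →ₗ[F] M} (hΦ : Φ ≠ 0) :
    ∃ z, InSupport z Φ := by
  let I : Ideal F[X] :=
    { carrier := {p | Kills p Φ}
      add_mem' := fun {a b} ha hb h => by rw [add_mul, map_add, ha, hb, add_zero]
      zero_mem' := fun h => by simp
      smul_mem' := fun c p hp => hp.mul_left c }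
  have hI : ∀ p, p ∈ I ↔ Kills p Φ := fun p => Iff.rfl
  obtain ⟨g, hg⟩ := IsPrincipalIdealRing.principal I
  have hgI : Kills g Φ := (hI g).mp (hg ▸ Ideal.mem_span_singleton_self g)
  have hdvd : ∀ p, Kills p Φ → g ∣ p := fun p hp => by
    rw [← hI, hg] at hp
    exact Ideal.mem_span_singleton.mp hp
  have hdeg : g.degree ≠ 0 := by
    intro h
    have hu := isUnit_iff_degree_eq_zero.mpr h
    obtain ⟨b, hb⟩ := hu.exists_right_inv
    apply hΦ
    ext1 n
    ext1
    simp only [LinearMap.comp_apply, LinearMap.zero_apply]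
    rw [← one_mul (monomial n (1 : F)), ← hb, mul_assoc]
    exact hgI _
  obtain ⟨z, hz⟩ := IsAlgClosed.exists_root g hdeg
  exact ⟨z, fun p hp => hz.dvd (hdvd p hp)⟩

/-- If `z` lies in the support of `Φ` and `z - a` does not, then `z` lies in the support of
`Φ - Φ ∘ taylor a`. -/
theorem InSupport.sub_comp_taylor {z a : F} {Φ : F[X] →ₗ[F] M} (hz : InSupport z Φ) {r : F[X]}
    (hr : Kills r Φ) (hrz : r.eval (z - a) ≠ 0) : InSupport z (Φ - Φ.comp (taylor a)) := by
  intro p hp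
  have h : Kills (p * taylor (-a) r) Φ := by
    have := (hp.mul_right (taylor (-a) r)).add ((hr.comp_taylor a).mul_left p)
    rwa [sub_add_cancel] at this
  have := hz _ h
  rw [eval_mul, taylor_eval, ← sub_eq_add_neg] at this
  exact (mul_eq_zero.mp this).resolve_right hrz

theorem InSupport.of_kills_sub {z : F} {Φ Ψ : F[X] →ₗ[F] M} (hz : InSupport z Φ) {r : F[X]}
    (hr : Kills r (Φ - Ψ)) (hrz : r.eval z ≠ 0) : InSupport z Ψ := by
  intro p hp
  have h : Kills (p * r) Φ := by
    have := (hr.mul_left p).add (hp.mul_right r)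
    rwa [sub_add_cancel] at this
  have := hz _ h
  rw [eval_mul] at this
  exact (mul_eq_zero.mp this).resolve_right hrz

theorem exists_mul_eq_of_pred [IsAlgClosed F] (P : F → Prop) {p : F[X]} (hp : p ≠ 0) :
    ∃ u w : F[X], u ≠ 0 ∧ p = u * w ∧ (∀ z, u.eval z = 0 → p.eval z = 0 ∧ P z) ∧
      (∀ z, w.eval z = 0 → p.eval z = 0 ∧ ¬ P z) := by
  classical
  set f : F → F[X] := fun x => X - C x
  set u := ((p.roots.filter P).map f).prod
  set w := ((p.roots.filter fun x => ¬ P x).map f).prod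
  have hpe : p = u * (C p.leadingCoeff * w) := by
    have h1 := (IsAlgClosed.splits p).eq_prod_roots
    have h2 : (p.roots.map f).prod = u * w := by
      rw [← Multiset.prod_add, ← Multiset.map_add, Multiset.filter_add_not]
    rw [h2] at h1
    calc p = C p.leadingCoeff * (u * w) := h1
      _ = u * (C p.leadingCoeff * w) := by ring
  have hroot : ∀ (s : Multiset F) (z : F), (s.map f).prod.eval z = 0 → z ∈ s := by
    intro s z h
    rw [eval_multiset_prod, Multiset.prod_eq_zero_iff, Multiset.map_map, Multiset.mem_map] at h
    obtain ⟨x, hx, hxz⟩ := h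
    have : z = x := by simpa [f, sub_eq_zero] using hxz
    exact this ▸ hx
  refine ⟨u, C p.leadingCoeff * w, ?_, hpe, fun z hz => ?_, fun z hz => ?_⟩
  · rintro h
    rw [h, zero_mul] at hpe
    exact hp hpe
  · have := Multiset.mem_filter.mp (hroot _ z hz)
    exact ⟨(mem_roots hp).mp this.1, this.2⟩
  · rw [eval_mul, eval_C] at hz
    have := Multiset.mem_filter.mp
      (hroot _ z ((mul_eq_zero.mp hz).resolve_left (leadingCoeff_ne_zero.mpr hp)))
    exact ⟨(mem_roots hp).mp this.1, this.2⟩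

theorem isCoprime_of_forall_eval [IsAlgClosed F] {p q : F[X]}
    (h : ∀ z, p.eval z = 0 → q.eval z = 0 → False) : IsCoprime p q := by
  rw [isCoprime_iff_aeval_ne_zero_of_isAlgClosed F F]
  intro z
  by_contra! hz
  simp only [coe_aeval_eq_eval] at hz
  exact h z hz.1 hz.2

theorem eq_zero_of_forall_taylor [CharZero F] {a : F} (ha : a ≠ 0) {Φ : F[X] →ₗ[F] M}
    (h : ∀ g, Φ g = Φ (taylor a g)) : Φ = 0 := by
  refine LinearMap.ext fun g => ?_
  obtain ⟨k, hk⟩ := exists_taylor_sub_eq ha g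
  rw [← hk, map_sub, ← h, sub_self, LinearMap.zero_apply]

theorem exists_int_bound [CharZero F] (R : Finset F) :
    ∃ s : ℕ, ∀ y ∈ R, ∀ y' ∈ R, ∀ j : ℤ, y = y' + j → j ≤ s := by
  classical
  let T : Finset (F × F) := R ×ˢ R
  have : ∀ t : F × F, ∃ s : ℕ, ∀ j : ℤ, t.1 = t.2 + j → j ≤ s := by
    intro t
    by_cases h : ∃ j : ℤ, t.1 = t.2 + j
    · obtain ⟨j, hj⟩ := h
      refine ⟨j.toNat, fun j' hj' => ?_⟩
      have : (j : F) = j' := add_left_cancel (hj.symm.trans hj')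
      have : j = j' := by exact_mod_cast this
      omega
    · exact ⟨0, fun j hj => (h ⟨j, hj⟩).elim⟩
  choose s hs using this
  refine ⟨T.sup s, fun y hy y' hy' j hj => (hs (y, y') j hj).trans ?_⟩
  exact_mod_cast Finset.le_sup (f := s) (Finset.mk_mem_product hy hy')

/-- A functional `Φ` such that the supports of the `Φ - Φ ∘ taylor n` are finite and of bounded
cardinality is itself annihilated by a nonzero polynomial. -/
theorem exists_kills_of_forall_sub_taylor [IsAlgClosed F] [CharZero F] [DecidableEq F]
    {Φ : F[X] →ₗ[F] M} (d : ℕ)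
    (h : ∀ n : ℕ, n ≠ 0 → ∃ p : F[X], p ≠ 0 ∧ p.roots.toFinset.card ≤ d ∧
      Kills p (Φ - Φ.comp (taylor (n : F)))) :
    ∃ q, q ≠ 0 ∧ Kills q Φ := by
  obtain ⟨q₁, hq₁, hd₁, hk₁⟩ := h 1 one_ne_zero
  set R₁ := q₁.roots.toFinset with hR₁
  have mem₁ : ∀ z, q₁.eval z = 0 → z ∈ R₁ := fun z hz => by
    rw [hR₁, Multiset.mem_toFinset, mem_roots hq₁]; exact hz
  obtain ⟨s, hs⟩ := exists_int_bound R₁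
  -- The shift `n` is so large that `R₁` and `R₁ + n` stay on opposite sides of a gap of height at
  -- most `d * d + 1`.
  set n : ℕ := s + d * d + 4 with hn
  obtain ⟨p, hp, hd, hk⟩ := h n (by omega)
  set R := p.roots.toFinset with hR
  have memR : ∀ z, p.eval z = 0 → z ∈ R := fun z hz => by
    rw [hR, Multiset.mem_toFinset, mem_roots hp]; exact hz
  -- There are at most `d * d` differences between `R` and `R₁`, so one of the first `d * d + 1`
  -- positive integers is not among them.
  obtain ⟨a, ha1, had, hgap⟩ : ∃ a : ℕ, 1 ≤ a ∧ a ≤ d * d + 1 ∧ ∀ y ∈ R₁, y + (a : F) ∉ R := by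
    by_contra! hcon
    have hsub : (Finset.Icc 1 (d * d + 1)).image (fun a : ℕ => (a : F)) ⊆
        (R ×ˢ R₁).image fun t => t.1 - t.2 := by
      intro x hx
      obtain ⟨a, ha, rfl⟩ := Finset.mem_image.mp hx
      obtain ⟨ha1, ha2⟩ := Finset.mem_Icc.mp ha
      obtain ⟨y, hy, hya⟩ := hcon a ha1 ha2
      exact Finset.mem_image.mpr ⟨(y + a, y), Finset.mk_mem_product hya hy, by simp⟩
    have h1 := Finset.card_le_card hsub
    rw [Finset.card_image_of_injective _ Nat.cast_injective, Nat.card_Icc] at h1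
    have h2 := h1.trans Finset.card_image_le
    rw [Finset.card_product] at h2
    have h3 := Nat.mul_le_mul hd hd₁
    omega
  -- `u` collects the roots of `p` to the left of the gap, `w` all others, including those in no
  -- coset `y + ℤ` with `y ∈ R₁`.
  let P : F → Prop := fun r => ∃ y ∈ R₁, ∃ j : ℤ, j < a ∧ r = y + j
  obtain ⟨u, w, hu, hpuw, hru, hrw⟩ := exists_mul_eq_of_pred P hp
  obtain ⟨c, e, hce⟩ : IsCoprime u w :=
    isCoprime_of_forall_eval fun z hz hz' => (hrw z hz').2 (hru z hz).2
  have no_gap : ∀ r, p.eval r = 0 → ∀ y ∈ R₁, ∀ j : ℤ, r = y + j → j ≠ a := by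
    rintro r hr y hy j hrj rfl
    apply hgap y hy
    rw [hrj] at hr
    exact memR _ (by simpa using hr)
  set Ψ := Φ - Φ.comp (taylor (n : F)) with hΨ
  set Ψ₁ := Φ - Φ.comp (taylor ((1 : ℕ) : F)) with hΨ₁
  -- `e * w` is the Bézout idempotent, so `Θ` is the part of `Ψ` supported on the roots of `u`.
  -- Formally `Ψ` is `Φ` minus a copy of `Φ` moved far to the right, so `Θ` should be `Φ` itself.
  let Θ : F[X] →ₗ[F] M := Ψ.comp (LinearMap.mulLeft F (e * w))
  have hΘ : ∀ g, Θ g = Ψ (e * w * g) := fun g => rfl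
  have hΘu : Kills u Θ := fun g => by
    rw [hΘ, show e * w * (u * g) = p * (e * g) by rw [hpuw]; ring]
    exact hk _
  have hΘw : Kills w (Ψ - Θ) := fun g => by
    rw [LinearMap.sub_apply, hΘ, ← map_sub,
      show w * g - e * w * (w * g) = p * (c * g) by
        rw [hpuw]; linear_combination (-w * g) * hce]
    exact hk _
  set S : F[X] →ₗ[F] F[X] := taylor ((1 : ℕ) : F) with hS
  set Ω := Θ - Θ.comp S - Ψ₁ with hΩ
  have hΩ1 : Kills (u * taylor (-((1 : ℕ) : F)) u * q₁) Ω :=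
    (((hΘu.mul_right _).sub ((hΘu.comp_taylor _).mul_left _)).mul_right _).sub (hk₁.mul_left _)
  -- The identity `Ψ - Ψ ∘ S = Ψ₁ - Ψ₁ ∘ taylor n` rewrites `Ω` through `Ψ - Θ` and the translate of
  -- `Ψ₁`, both to the right of the gap; `hΩ1` places `Ω` on the left.
  have hΩ2 : Kills (w * taylor (-((1 : ℕ) : F)) w * taylor (-(n : F)) q₁) Ω := by
    have : Ω = 0 - (((Ψ - Θ) - (Ψ - Θ).comp S) + Ψ₁.comp (taylor (n : F))) := by
      have hcomm : ∀ g, S (taylor (n : F) g) = taylor (n : F) (S g) := fun g => by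
        rw [hS, taylor_taylor, taylor_taylor, add_comm]
      refine LinearMap.ext fun g => ?_
      simp only [hΩ, hΨ, hΨ₁, LinearMap.sub_apply, LinearMap.add_apply, LinearMap.comp_apply,
        LinearMap.zero_apply, hcomm]
      abel
    rw [this]
    refine Kills.sub (fun g => rfl) ?_
    exact (((hΘw.mul_right _).sub ((hΘw.comp_taylor _).mul_left _)).mul_right _).add
      ((hk₁.comp_taylor _).mul_left _)
  have hΩ0 : Ω = 0 := by
    refine hΩ1.eq_zero_of_isCoprime hΩ2 (isCoprime_of_forall_eval fun z hz hz' => ?_)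
    simp only [eval_mul, mul_eq_zero, taylor_eval, Nat.cast_one] at hz hz'
    have hu' : ∀ t, u.eval t = 0 → p.eval t = 0 ∧ ∃ y ∈ R₁, ∃ j : ℤ, j < a ∧ t = y + j := hru
    have hw' : ∀ t, w.eval t = 0 → p.eval t = 0 ∧
        ∀ y ∈ R₁, ∀ j : ℤ, t = y + j → (a : ℤ) < j := fun t ht =>
      ⟨(hrw t ht).1, fun y hy j hj => lt_of_le_of_ne
        (not_lt.mp fun hlt => (hrw t ht).2 ⟨y, hy, j, hlt, hj⟩)
        (no_gap t (hrw t ht).1 y hy j hj).symm⟩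
    have left : ∃ y ∈ R₁, ∃ j : ℤ, j ≤ a ∧ z = y + j := by
      rcases hz with (hz | hz) | hz
      · obtain ⟨-, y, hy, j, hj, e⟩ := hu' _ hz
        exact ⟨y, hy, j, hj.le, e⟩
      · obtain ⟨-, y, hy, j, hj, e⟩ := hu' _ hz
        exact ⟨y, hy, j + 1, by omega, by push_cast; linear_combination e⟩
      · exact ⟨z, mem₁ z hz, 0, by omega, by simp⟩
    obtain ⟨y, hy, j, hj, rfl⟩ := left
    rcases hz' with (hz' | hz') | hz'
    · have := (hw' _ hz').2 y hy j rfl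
      omega
    · have h1 := (hw' _ hz').2 y hy (j - 1) (by push_cast; ring)
      omega
    · have h1 := hs y hy _ (mem₁ _ hz') (n - j) (by push_cast; ring)
      omega
  refine ⟨u, hu, ?_⟩
  -- `Ω = 0` says that `Φ - Θ` is invariant under the unit shift, and a shift-invariant functional
  -- vanishes.
  have hΦ : Φ - Θ = 0 := by
    refine eq_zero_of_forall_taylor (a := ((1 : ℕ) : F)) (by simp) fun g => ?_
    have := LinearMap.congr_fun hΩ0 g
    simp only [hΩ, hΨ₁, LinearMap.sub_apply, LinearMap.comp_apply, LinearMap.zero_apply] at this ⊢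
    rw [← sub_eq_zero, ← neg_eq_zero, ← this]
    abel
  rw [sub_eq_zero.mp hΦ]
  exact hΘu

end Functionals

/-! ### Weights of uniformly bounded modules -/

section Weights

variable {F : Type*} [Field F]

theorem exists_nat_forall_eval_ne_zero [CharZero F] {R : F[X]} (hR : R ≠ 0) (y : F) {c : F}
    (hc : c ≠ 0) : ∃ A : ℕ, ∀ j : ℕ, A ≤ j → R.eval (y + c * j) ≠ 0 := by
  have hinj : Function.Injective fun j : ℕ => y + c * (j : F) := fun i j hij => by
    have : c * (i : F) = c * j := add_left_cancel hij
    exact_mod_cast mul_left_cancel₀ hc this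
  have hfin : {j : ℕ | R.eval (y + c * j) = 0}.Finite :=
    Set.Finite.preimage hinj.injOn (R.finite_setOfPred_isRoot hR)
  obtain ⟨A, hA⟩ := hfin.bddAbove
  exact ⟨A + 1, fun j hj h0 => absurd (hA h0) (by omega)⟩

theorem eq_of_forall_eval_add_eq {u w u' w' a b a' b' : F} (ha : a ≠ 0) (huw : u ≠ w)
    (huw' : u ≠ w')
    (h : ∀ g : F[X], a * g.eval u + b * g.eval w = a' * g.eval u' + b' * g.eval w') :
    u = u' := by
  by_contra hne
  have := h ((X - C w) * (X - C w') * (X - C u'))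
  simp only [eval_mul, eval_sub, eval_X, eval_C, sub_self, mul_zero, zero_mul, add_zero] at this
  exact mul_ne_zero ha (mul_ne_zero (mul_ne_zero (sub_ne_zero.mpr huw) (sub_ne_zero.mpr huw'))
    (sub_ne_zero.mpr hne)) this

/-- `htrans` says that each point in the support of `l - l ∘ taylor α` creates a new weight. For any
other `l` two independent moves, of sizes `a` and `b`, are always possible; their results are
distinct, and pigeonhole on degrees exceeds `N`. -/
theorem isWeight_eq_leval [IsAlgClosed F] [CharZero F] [DecidableEq F]
    (P : ℤ → Set (F[X] →ₗ[F] F)) (N d : ℕ)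
    (hcard : ∀ (k : ℤ) (s : Finset (F[X] →ₗ[F] F)), (s : Set (F[X] →ₗ[F] F)) ⊆ P k → s.card ≤ N)
    (htrans : ∀ k, ∀ l ∈ P k, ∀ α : ℤ, α ≠ 0 → ∃ p : F[X], p ≠ 0 ∧ p.roots.toFinset.card ≤ d ∧
      Kills p (l - l.comp (taylor (α : F))) ∧ ∀ y, p.eval y = 0 →
        l + leval (y - α) - leval y ∈ P (k - α) ∨ l + leval y - leval (y - α) ∈ P (k + α))
    {k : ℤ} {l : F[X] →ₗ[F] F} (hl : l ∈ P k) :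
    l = 0 ∨ ∃ x, l = leval x ∨ l = -leval x := by
  classical
  by_contra! hcon
  obtain ⟨hl0, hlev⟩ := hcon
  obtain ⟨Q, hQ, hQl⟩ : ∃ q, q ≠ 0 ∧ Kills q l := by
    refine exists_kills_of_forall_sub_taylor d fun n hn => ?_
    obtain ⟨p, hp, hpd, hk, -⟩ := htrans k l hl n (by exact_mod_cast hn)
    exact ⟨p, hp, hpd, by simpa using hk⟩
  obtain ⟨y, hy⟩ := exists_inSupport hl0
  -- After the first move the weight is `l ± leval y` plus an evaluation far away. This is where `l
  -- ≠ ± leval y` is needed: a second support point `z e` remains for the second move.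
  have hz : ∀ e : ℤ, e = 1 ∨ e = -1 → ∃ z, InSupport z (l + e • leval y) := by
    rintro e (rfl | rfl)
    · refine exists_inSupport fun h => (hlev y).2 ?_
      rw [one_smul] at h
      exact eq_neg_of_add_eq_zero_left h
    · refine exists_inSupport fun h => (hlev y).1 ?_
      rw [neg_smul, one_smul, ← sub_eq_add_neg] at h
      exact sub_eq_zero.mp h
  choose! z hz using hz
  set R : F[X] := Q * (X - C y) * (X - C (z 1)) * (X - C (z (-1))) with hR
  have hR0 : R ≠ 0 := mul_ne_zero (mul_ne_zero (mul_ne_zero hQ (X_sub_C_ne_zero _))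
    (X_sub_C_ne_zero _)) (X_sub_C_ne_zero _)
  have hRQ : ∀ x, R.eval x ≠ 0 → Q.eval x ≠ 0 := fun x hx h => hx (by simp [hR, h])
  have hRy : R.eval y = 0 := by simp [hR]
  have hRz : ∀ e : ℤ, e = 1 ∨ e = -1 → R.eval (z e) = 0 := by
    rintro e (rfl | rfl) <;> simp [hR]
  have hRl : Kills R l := ((hQl.mul_right _).mul_right _).mul_right _
  obtain ⟨A, hA0, hAy, hAz⟩ : ∃ A : ℕ, 0 < A ∧ (∀ j : ℕ, A ≤ j → R.eval (y - j) ≠ 0) ∧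
      ∀ e : ℤ, e = 1 ∨ e = -1 → ∀ j : ℕ, A ≤ j → R.eval (z e + j) ≠ 0 := by
    obtain ⟨A₁, h₁⟩ := exists_nat_forall_eval_ne_zero hR0 y (neg_ne_zero.mpr one_ne_zero)
    obtain ⟨A₂, h₂⟩ := exists_nat_forall_eval_ne_zero hR0 (z 1) one_ne_zero
    obtain ⟨A₃, h₃⟩ := exists_nat_forall_eval_ne_zero hR0 (z (-1)) one_ne_zero
    refine ⟨A₁ + A₂ + A₃ + 1, by omega, fun j hj => ?_, ?_⟩
    · have := h₁ j (by omega)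
      rwa [neg_one_mul, ← sub_eq_add_neg] at this
    · rintro e (rfl | rfl) j hj
      · have := h₂ j (by omega)
        rwa [one_mul] at this
      · have := h₃ j (by omega)
        rwa [one_mul] at this
  have hne : ∀ e : ℤ, e = 1 ∨ e = -1 → ∀ i j : ℕ, A ≤ i → y - i ≠ z e + j := by
    intro e he i j hi h
    apply hAy (i + j) (by omega)
    rw [Nat.cast_add, show y - ((i : F) + j) = z e by linear_combination h]
    exact hRz e he
  -- For large `a` the point `y - a` is outside the support of `l`, so `y` survives in `l - l ∘
  -- taylor a`. The sign `e` records which alternative of `htrans` occurs.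
  have step1 : ∀ a : ℕ, A ≤ a → ∃ e : ℤ, (e = 1 ∨ e = -1) ∧
      l + e • (leval y - leval (y - a)) ∈ P (k + e * a) := by
    intro a ha
    obtain ⟨p, -, -, hp, hpy⟩ := htrans k l hl a (by omega)
    have hy0 := hy.sub_comp_taylor hQl (hRQ _ (hAy a ha)) p (by simpa using hp)
    rcases hpy y hy0 with h | h
    · refine ⟨-1, Or.inr rfl, ?_⟩
      convert h using 2
      · ring
      · push_cast; module
    · refine ⟨1, Or.inl rfl, ?_⟩
      convert h using 2
      · ring
      · push_cast; module
  choose! e he hstep1 using step1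
  have step2 : ∀ a b : ℕ, A ≤ a → A ≤ b → ∃ e' : ℤ, (e' = 1 ∨ e' = -1) ∧
      l + e a • (leval y - leval (y - a)) + e' • (leval (z (e a)) - leval (z (e a) + b)) ∈
        P (k + e a * a - e' * b) := by
    intro a b ha hb
    set l' := l + e a • (leval y - leval (y - a)) with hl'
    -- The second move uses `-b`, so its new point `z + b` lies on the other side from `y - a` and
    -- `hne` keeps the two apart.
    obtain ⟨p, -, -, hp, hpy⟩ := htrans _ l' (hstep1 a ha) (-b) (by omega)
    have hsupp : InSupport (z (e a)) l' := by
      refine (hz _ (he a ha)).of_kills_sub (r := X - C (y - a)) (fun h => ?_) ?_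
      · simp [hl', leval]
      · rw [eval_sub, eval_X, eval_C, sub_ne_zero]
        intro h
        apply hne (e a) (he a ha) a 0 ha
        rw [h]; simp
    have hkill : Kills (R * (X - C (y - a))) l' := by
      refine (hRl.mul_right _).add fun h => ?_
      simp [leval, hRy]
    have hz0 := hsupp.sub_comp_taylor (a := -(b : F)) hkill (by
      rw [sub_neg_eq_add, eval_mul, eval_sub, eval_X, eval_C]
      exact mul_ne_zero (hAz _ (he a ha) b hb)
        (sub_ne_zero.mpr (hne _ (he a ha) a b ha).symm)) p (by simpa using hp)
    rcases hpy _ hz0 with h | h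
    · refine ⟨-1, Or.inr rfl, ?_⟩
      convert h using 2
      · ring
      · push_cast; rw [sub_neg_eq_add]; module
    · refine ⟨1, Or.inl rfl, ?_⟩
      convert h using 2
      · ring
      · push_cast; rw [sub_neg_eq_add]; module
  choose! e' he' hstep2 using step2
  set m : ℕ × ℕ → (F[X] →ₗ[F] F) := fun t => l + e t.1 • (leval y - leval (y - t.1)) +
    e' t.1 t.2 • (leval (z (e t.1)) - leval (z (e t.1) + t.2)) with hm
  have hcast : ∀ e : ℤ, e = 1 ∨ e = -1 → (e : F) ≠ 0 := by
    rintro e (rfl | rfl) <;> simp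
  -- Multiplication by `R` erases `l`, `leval y` and `leval (z e)`; only the evaluations at `y - a`
  -- and `z + b` remain, and they recover `a` and `b`.
  have htest : ∀ a b : ℕ, A ≤ a → A ≤ b → ∀ g : F[X], m (a, b) (R * g) =
      (-e a * R.eval (y - a)) * g.eval (y - a) +
        (-e' a b * R.eval (z (e a) + b)) * g.eval (z (e a) + b) := by
    intro a b ha hb g
    simp only [hm, LinearMap.add_apply, LinearMap.smul_apply, LinearMap.sub_apply, leval_apply,
      eval_mul, hRl g, hRy, hRz _ (he a ha), zsmul_eq_mul]
    ring
  have hinj : ∀ a b a' b' : ℕ, A ≤ a → A ≤ b → A ≤ a' → A ≤ b' → m (a, b) = m (a', b') →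
      a = a' ∧ b = b' := by
    intro a b a' b' ha hb ha' hb' hmm
    have key := fun g => (htest a b ha hb g).symm.trans
      ((LinearMap.congr_fun hmm (R * g)).trans (htest a' b' ha' hb' g))
    have h1 : y - (a : F) = y - (a' : F) := eq_of_forall_eval_add_eq
      (mul_ne_zero (neg_ne_zero.mpr (hcast _ (he a ha))) (hAy a ha))
      (hne _ (he a ha) a b ha) (hne _ (he a' ha') a b' ha) key
    have h2 : a = a' := by
      have : (a : F) = a' := by linear_combination -h1
      exact_mod_cast this
    subst h2
    have h3 : z (e a) + (b : F) = z (e a) + (b' : F) := eq_of_forall_eval_add_eq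
      (mul_ne_zero (neg_ne_zero.mpr (hcast _ (he' a b ha hb))) (hAz _ (he a ha) b hb))
      (hne _ (he a ha) a b ha).symm (hne _ (he a ha) a b ha).symm
      (fun g => by rw [add_comm, key g, add_comm])
    exact ⟨rfl, by exact_mod_cast add_left_cancel h3⟩
  -- Chosen so that `n * n` pairs exceed `N` times the `4 * (A + n) + 1` available degrees.
  set n : ℕ := 4 * N + 4 * N * A + N + 1 with hn
  set s : Finset (ℕ × ℕ) := Finset.Ico A (A + n) ×ˢ Finset.Ico A (A + n) with hs
  have hsA : ∀ t ∈ s, A ≤ t.1 ∧ A ≤ t.2 ∧ t.1 < A + n ∧ t.2 < A + n := by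
    intro t ht
    rw [hs, Finset.mem_product, Finset.mem_Ico, Finset.mem_Ico] at ht
    omega
  obtain ⟨i, -, hi⟩ := Finset.exists_lt_card_fiber_of_mul_lt_card_of_maps_to (s := s)
    (t := Finset.Icc (k - 2 * (A + n : ℕ)) (k + 2 * (A + n : ℕ)))
    (f := fun t => k + e t.1 * t.1 - e' t.1 t.2 * t.2) (n := N) (by
      intro t ht
      obtain ⟨h1, h2, h3, h4⟩ := hsA t ht
      rw [Finset.mem_Icc]
      rcases he t.1 h1 with h | h <;> rcases he' t.1 t.2 h1 h2 with h' | h' <;> rw [h, h'] <;>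
        omega) (by
      rw [Int.card_Icc, hs, Finset.card_product, Nat.card_Ico]
      have : (k + 2 * ((A + n : ℕ) : ℤ) + 1 - (k - 2 * ((A + n : ℕ) : ℤ))).toNat =
        4 * (A + n) + 1 := by omega
      rw [this, Nat.add_sub_cancel_left]
      nlinarith [Nat.zero_le (N * A), Nat.zero_le (N * n), Nat.zero_le ((4 * N * A + N) * n)])
  have hle := hcard i ((s.filter fun t => k + e t.1 * t.1 - e' t.1 t.2 * t.2 = i).image m) (by
    intro x hx
    obtain ⟨t, ht, rfl⟩ := Finset.mem_image.mp hx
    obtain ⟨hts, rfl⟩ := Finset.mem_filter.mp ht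
    obtain ⟨h1, h2, -, -⟩ := hsA t hts
    exact hstep2 t.1 t.2 h1 h2)
  rw [Finset.card_image_of_injOn] at hle
  · omega
  · intro t ht t' ht' htt
    obtain ⟨h1, h2, -, -⟩ := hsA t (Finset.mem_filter.mp ht).1
    obtain ⟨h1', h2', -, -⟩ := hsA t' (Finset.mem_filter.mp ht').1
    have := hinj t.1 t.2 t'.1 t'.2 h1 h2 h1' h2' htt
    exact Prod.ext this.1 this.2

end Weights

/-! ### Graded representations and their weights -/

section Representations

variable {F : Type*} [Field F] {V : Type*} [AddCommGroup V] [Module F V]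

/-- `ψ α f` is the operator by which `t ^ α f(D)` acts on a graded `𝒲`-module. -/
structure IsGradedRep (𝒱 : ℤ → Submodule F V) (ψ : ℤ → F[X] →ₗ[F] Module.End F V) : Prop where
  comm : ∀ (α β : ℤ) (f g : F[X]) (v : V), ψ α f (ψ β g v) - ψ β g (ψ α f v) =
    ψ (α + β) (taylor (β : F) f * g - f * taylor (α : F) g) v
  mem : ∀ (α : ℤ) (f : F[X]) (k : ℤ), ∀ v ∈ 𝒱 k, ψ α f v ∈ 𝒱 (k + α)

/-- The weights of the degree `k` part: the simultaneous eigenvalues of the `f(D)`. -/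
def weights (𝒱 : ℤ → Submodule F V) (ψ : ℤ → F[X] →ₗ[F] Module.End F V) (k : ℤ) :
    Set (F[X] →ₗ[F] F) :=
  {l | ∃ v ∈ 𝒱 k, v ≠ 0 ∧ ∀ g, ψ 0 g v = l g • v}

variable {𝒱 : ℤ → Submodule F V} {ψ : ℤ → F[X] →ₗ[F] Module.End F V}

namespace IsGradedRep

variable (hψ : IsGradedRep 𝒱 ψ)
include hψ

theorem comm_zero (f g : F[X]) (v : V) : ψ 0 f (ψ 0 g v) = ψ 0 g (ψ 0 f v) := by
  have := hψ.comm 0 0 f g v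
  rwa [Int.cast_zero, taylor_zero, taylor_zero, sub_self, map_zero, LinearMap.zero_apply,
    sub_eq_zero] at this

theorem zero_comp (α : ℤ) (f g : F[X]) (v : V) :
    ψ 0 g (ψ α f v) = ψ α ((taylor (α : F) g - g) * f) v + ψ α f (ψ 0 g v) := by
  have := hψ.comm 0 α g f v
  rw [Int.cast_zero, taylor_zero, zero_add, ← sub_mul] at this
  rw [← this, sub_add_cancel]

theorem mem_zero (f : F[X]) {k : ℤ} {v : V} (hv : v ∈ 𝒱 k) : ψ 0 f v ∈ 𝒱 k := by
  simpa using hψ.mem 0 f k v hv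

/-- The commutator of `t^α f(D)` and `t^(-α) g(D)` lies in degree zero and kills `v`; this turns
annihilation by nonzero degrees into a difference equation for the degree-zero action. -/
theorem eq_taylor_of_apply_eq_zero {α : ℤ} {f g : F[X]} {v : V}
    (hf : ψ α f v = 0) (hg : ψ (-α) g v = 0) :
    ψ 0 (taylor (-(α : F)) f * g) v = ψ 0 (taylor (α : F) (taylor (-(α : F)) f * g)) v := by
  have h1 := hψ.comm α (-α) f g v
  rw [hf, hg, map_zero, map_zero, sub_zero, add_neg_cancel, eq_comm, map_sub,
    LinearMap.sub_apply, sub_eq_zero, Int.cast_neg] at h1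
  rw [h1, taylor_mul, taylor_taylor, add_neg_cancel, taylor_zero]

/-- If every `g(D)` is scalar on `E`, any vector works and the scalars are linear in `g`; otherwise
a proper eigenspace is stable under all the commuting operators and has smaller dimension. -/
theorem exists_weight_of_le [IsAlgClosed F] {k : ℤ} [FiniteDimensional F (𝒱 k)]
    (E : Submodule F V) (hE : E ≤ 𝒱 k) (hE0 : E ≠ ⊥) (hstab : ∀ g, ∀ v ∈ E, ψ 0 g v ∈ E) :
    ∃ l : F[X] →ₗ[F] F, ∃ v ∈ E, v ≠ 0 ∧ ∀ g, ψ 0 g v = l g • v := by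
  induction hn : Module.finrank F E using Nat.strong_induction_on generalizing E with
  | _ n ih =>
    have : FiniteDimensional F E := Submodule.finiteDimensional_of_le hE
    have hnt : Nontrivial E := (Submodule.nontrivial_iff_ne_bot).mpr hE0
    by_cases hsc : ∀ g, ∃ c : F, ∀ v ∈ E, ψ 0 g v = c • v
    · choose c hc using hsc
      obtain ⟨v, hv, hv0⟩ := (Submodule.ne_bot_iff E).mp hE0
      have inj : ∀ a b : F, a • v = b • v → a = b := fun a b h => smul_left_injective F hv0 h
      refine ⟨{ toFun := c, map_add' := fun f g => inj _ _ ?_, map_smul' := fun r f => inj _ _ ?_ },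
        v, hv, hv0, fun g => hc g v hv⟩
      · rw [← hc _ v hv, add_smul, ← hc _ v hv, ← hc _ v hv, map_add, LinearMap.add_apply]
      · rw [← hc _ v hv, RingHom.id_apply, smul_assoc, ← hc _ v hv, map_smul,
          LinearMap.smul_apply]
    · push Not at hsc
      obtain ⟨g, hg⟩ := hsc
      obtain ⟨c, hc⟩ := Module.End.exists_eigenvalue ((ψ 0 g).restrict (hstab g))
      obtain ⟨w, hw⟩ := hc.exists_hasEigenvector
      have hw1 : ψ 0 g w = c • (w : V) := congrArg Subtype.val hw.apply_eq_smul
      obtain ⟨v, hv, hv1⟩ := hg c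
      set E' : Submodule F V := E ⊓ (ψ 0 g).eigenspace c
      have hlt : E' < E := by
        refine lt_of_le_of_ne inf_le_left fun h => hv1 ?_
        have : v ∈ E' := h ▸ hv
        exact Module.End.mem_eigenspace_iff.mp this.2
      obtain ⟨l, v', hv', h⟩ := ih _ (hn ▸ Submodule.finrank_lt_finrank_of_lt hlt) E'
        (hlt.le.trans hE) ((Submodule.ne_bot_iff E').mpr ⟨w, ⟨w.2,
          Module.End.mem_eigenspace_iff.mpr hw1⟩, fun h => hw.2 (Subtype.ext h)⟩)
        (fun f u hu => ⟨hstab f u hu.1, Module.End.mem_eigenspace_iff.mpr (by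
          rw [hψ.comm_zero, Module.End.mem_eigenspace_iff.mp hu.2, map_smul])⟩) rfl
      exact ⟨l, v', hv'.1, h⟩

theorem card_weights_le {k : ℤ} [FiniteDimensional F (𝒱 k)] {N : ℕ}
    (hN : Module.finrank F (𝒱 k) ≤ N) (s : Finset (F[X] →ₗ[F] F))
    (hs : (s : Set (F[X] →ₗ[F] F)) ⊆ weights 𝒱 ψ k) : s.card ≤ N := by
  have hind := Module.End.independent_iInf_maxGenEigenspace_of_forall_mapsTo (ψ 0 : F[X] → _)
    (fun f g c => Module.End.mapsTo_maxGenEigenspace_of_comm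
      (LinearMap.ext fun v => hψ.comm_zero g f v) c)
  have hinj : Function.Injective fun l : s => ((l : F[X] →ₗ[F] F) : F[X] → F) :=
    fun l l' h => Subtype.ext (DFunLike.coe_injective h)
  choose v hv hv0 hvl using fun l : s => hs l.2
  have hli := (hind.comp hinj).linearIndependent _ (v := v) (fun l => by
    refine (Submodule.mem_iInf _).mpr fun g => ?_
    have : v l ∈ (ψ 0 g).eigenspace ((l : F[X] →ₗ[F] F) g) :=
      Module.End.mem_eigenspace_iff.mpr (hvl l g)
    exact Module.End.genEigenspace_le_maximal _ _ 1 this) hv0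
  have hli' : LinearIndependent F fun l : s => (⟨v l, hv l⟩ : 𝒱 k) :=
    LinearIndependent.of_comp (𝒱 k).subtype hli
  have := hli'.fintype_card_le_finrank
  rw [Fintype.card_coe] at this
  exact this.trans hN

/-- `m` generates the ideal of all `f` with `t^α f(D) v = 0`. At a root `y`, the cofactor `m'`
satisfies `h * m' ≡ h(y) m'` modulo `m`, so `t^α m'(D) v` is a nonzero joint eigenvector. -/
theorem exists_generator [CharZero F] {k α : ℤ} (hα : α ≠ 0) [FiniteDimensional F (𝒱 (k + α))]
    {l : F[X] →ₗ[F] F} {v : V} (hv : v ∈ 𝒱 k) (hvl : ∀ g, ψ 0 g v = l g • v) :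
    ∃ m : F[X], m ≠ 0 ∧ (∀ h, ψ α (m * h) v = 0) ∧
      ∀ y, m.eval y = 0 → l + leval (y + α) - leval y ∈ weights 𝒱 ψ (k + α) := by
  have hα' : (α : F) ≠ 0 := Int.cast_ne_zero.mpr hα
  have hz : ∀ g f, ψ 0 g (ψ α f v) = ψ α ((taylor (α : F) g - g) * f) v + l g • ψ α f v := by
    intro g f
    rw [hψ.zero_comp, hvl, map_smul]
  let J : Ideal F[X] :=
    { carrier := {f | ψ α f v = 0}
      add_mem' := fun {a b} ha hb => by
        simp only [Set.mem_ofPred_eq] at *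
        rw [map_add, LinearMap.add_apply, ha, hb, add_zero]
      zero_mem' := by simp
      smul_mem' := fun c f hf => by
        simp only [Set.mem_ofPred_eq, smul_eq_mul] at *
        obtain ⟨g, rfl⟩ := exists_taylor_sub_eq hα' c
        have := hz g f
        rwa [hf, map_zero, smul_zero, add_zero, eq_comm] at this }
  have hJ : ∀ f, f ∈ J ↔ ψ α f v = 0 := fun f => Iff.rfl
  obtain ⟨m, hm⟩ := IsPrincipalIdealRing.principal J
  have hmJ : ∀ f, m ∣ f ↔ ψ α f v = 0 := fun f => by
    rw [← hJ, hm]; exact Ideal.mem_span_singleton.symm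
  have hm0 : m ≠ 0 := by
    rintro rfl
    let θ : F[X] →ₗ[F] 𝒱 (k + α) :=
      ((ψ α : F[X] →ₗ[F] V →ₗ[F] V).flip v).codRestrict _ fun f => hψ.mem α f k v hv
    have hθ : Function.Injective θ := by
      rw [injective_iff_map_eq_zero]
      intro f hf
      exact zero_dvd_iff.mp ((hmJ f).mpr (congrArg Subtype.val hf))
    exact Polynomial.not_finite (R := F) (Module.Finite.of_injective θ hθ)
  refine ⟨m, hm0, fun h => (hmJ _).mp (Dvd.intro h rfl), fun y hy => ?_⟩
  obtain ⟨m', hm'⟩ := dvd_iff_isRoot.mpr hy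
  have hm'0 : ψ α m' v ≠ 0 := by
    rw [Ne, ← hmJ]
    rintro ⟨c, hc⟩
    have h1 : m * (1 - (X - C y) * c) = 0 := by
      linear_combination hm' + (X - C y) * hc
    have h2 := (mul_eq_zero.mp h1).resolve_left hm0
    simpa using congrArg (eval y) h2
  refine ⟨ψ α m' v, hψ.mem α m' k v hv, hm'0, fun g => ?_⟩
  obtain ⟨q, hq⟩ := X_sub_C_dvd_sub_C_eval (a := y) (p := taylor (α : F) g - g)
  have : ψ α ((taylor (α : F) g - g) * m') v = (g.eval (y + α) - g.eval y) • ψ α m' v := by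
    have h1 : (taylor (α : F) g - g) * m' = m * q + (g.eval (y + α) - g.eval y) • m' := by
      rw [eval_sub, taylor_eval] at hq
      rw [hm', smul_eq_C_mul]
      linear_combination m' * hq
    rw [h1, map_add, LinearMap.add_apply, (hmJ _).mp (Dvd.intro q rfl), zero_add, map_smul,
      LinearMap.smul_apply]
  rw [hz, this]
  simp only [LinearMap.sub_apply, LinearMap.add_apply, leval_apply]
  module

theorem exists_transition [CharZero F] [DecidableEq F] {N : ℕ}
    (hfin : ∀ k, FiniteDimensional F (𝒱 k)) (hN : ∀ k, Module.finrank F (𝒱 k) ≤ N)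
    (k : ℤ) (l : F[X] →ₗ[F] F) (hl : l ∈ weights 𝒱 ψ k) (α : ℤ) (hα : α ≠ 0) :
    ∃ p : F[X], p ≠ 0 ∧ p.roots.toFinset.card ≤ 2 * N ∧
      Kills p (l - l.comp (taylor (α : F))) ∧ ∀ y, p.eval y = 0 →
        l + leval (y - α) - leval y ∈ weights 𝒱 ψ (k - α) ∨
          l + leval y - leval (y - α) ∈ weights 𝒱 ψ (k + α) := by
  classical
  obtain ⟨v, hv, hv0, hvl⟩ := hl
  have gen : ∀ γ : ℤ, γ ≠ 0 → ∃ m : F[X], m ≠ 0 ∧ m.roots.toFinset.card ≤ N ∧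
      (∀ h, ψ γ (m * h) v = 0) ∧
      ∀ y, m.eval y = 0 → l + leval (y + γ) - leval y ∈ weights 𝒱 ψ (k + γ) := by
    intro γ hγ
    obtain ⟨m, hm, hmk, hmw⟩ := hψ.exists_generator hγ hv hvl
    refine ⟨m, hm, ?_, hmk, hmw⟩
    -- The test polynomial is `X ^ 2` because on `X` all these weights take the same value `l X +
    -- γ`.
    have hinj : Function.Injective fun y : F => l + leval (y + γ) - leval y := by
      intro y y' h
      have := LinearMap.congr_fun h (X ^ 2)
      simp only [LinearMap.sub_apply, LinearMap.add_apply, leval_apply, eval_pow, eval_X] at this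
      have h2 : (2 * (γ : F)) * y = (2 * (γ : F)) * y' := by linear_combination this
      exact mul_left_cancel₀ (mul_ne_zero two_ne_zero (Int.cast_ne_zero.mpr hγ)) h2
    rw [← Finset.card_image_of_injective _ hinj]
    refine hψ.card_weights_le (hN (k + γ)) _ fun x hx => ?_
    obtain ⟨y, hy, rfl⟩ := Finset.mem_image.mp hx
    exact hmw y ((mem_roots hm).mp (Multiset.mem_toFinset.mp hy))
  obtain ⟨m₁, hm₁, hc₁, hk₁, hw₁⟩ := gen α hα
  obtain ⟨m₂, hm₂, hc₂, hk₂, hw₂⟩ := gen (-α) (neg_ne_zero.mpr hα)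
  have hp : m₂ * taylor (-(α : F)) m₁ ≠ 0 :=
    mul_ne_zero hm₂ (by rwa [Ne, taylor_eq_zero])
  have hroot : ∀ y, (m₂ * taylor (-(α : F)) m₁).eval y = 0 →
      m₂.eval y = 0 ∨ m₁.eval (y - α) = 0 := by
    intro y hy
    rwa [eval_mul, taylor_eval, ← sub_eq_add_neg, mul_eq_zero] at hy
  refine ⟨m₂ * taylor (-(α : F)) m₁, hp, ?_, fun h => ?_, fun y hy => ?_⟩
  · have hsub : (m₂ * taylor (-(α : F)) m₁).roots.toFinset ⊆
        m₂.roots.toFinset ∪ m₁.roots.toFinset.image (· + (α : F)) := by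
      intro y hy
      rw [Multiset.mem_toFinset, mem_roots hp] at hy
      rw [Finset.mem_union, Finset.mem_image]
      rcases hroot y hy with h | h
      · exact Or.inl (by rw [Multiset.mem_toFinset, mem_roots hm₂]; exact h)
      · exact Or.inr ⟨y - α, by rw [Multiset.mem_toFinset, mem_roots hm₁]; exact h, by simp⟩
    have h1 := (Finset.card_le_card hsub).trans (Finset.card_union_le _ _)
    have h2 := Finset.card_image_le (s := m₁.roots.toFinset) (f := (· + (α : F)))
    omega
  · have h1 := hψ.eq_taylor_of_apply_eq_zero (hk₁ 1) (hk₂ h)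
    rw [mul_one, hvl, hvl, mul_left_comm, ← mul_assoc] at h1
    rw [LinearMap.sub_apply, LinearMap.comp_apply, smul_left_injective F hv0 h1, sub_self]
  · rcases hroot y hy with h | h
    · left
      simpa [sub_eq_add_neg] using hw₂ y h
    · right
      simpa using hw₁ _ h

theorem weights_eq_leval [IsAlgClosed F] [CharZero F] {N : ℕ}
    (hfin : ∀ k, FiniteDimensional F (𝒱 k)) (hN : ∀ k, Module.finrank F (𝒱 k) ≤ N)
    {k : ℤ} {l : F[X] →ₗ[F] F} (hl : l ∈ weights 𝒱 ψ k) :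
    l = 0 ∨ ∃ x, l = leval x ∨ l = -leval x := by
  classical
  exact isWeight_eq_leval (weights 𝒱 ψ) N (2 * N)
    (fun k s hs => hψ.card_weights_le (hN k) s hs) (hψ.exists_transition hfin hN) hl

end IsGradedRep

end Representations

/-! ### Representations with weights `leval (a + k)` -/

section Generalized

variable {F : Type*} [Field F] {V : Type*} [AddCommGroup V] [Module F V]

theorem exists_pow_sub_smul_eq_zero [IsAlgClosed F] (T : Module.End F V) (E : Submodule F V)
    [FiniteDimensional F E] (hT : ∀ v ∈ E, T v ∈ E) (c₀ : F)
    (h : ∀ v ∈ E, v ≠ 0 → ∀ c, T v = c • v → c = c₀) :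
    ∃ M : ℕ, ∀ v ∈ E, ((T - c₀ • 1) ^ M) v = 0 := by
  set T' : Module.End F E := T.restrict hT
  have hbot : ∀ c, c ≠ c₀ → T'.maxGenEigenspace c = ⊥ := by
    intro c hc
    by_contra hne
    have h1 : T'.HasUnifEigenvalue c ⊤ := hne
    rw [Module.End.hasUnifEigenvalue_iff_hasUnifEigenvalue_one (by simp)] at h1
    obtain ⟨w, hw⟩ := Module.End.HasEigenvalue.exists_hasEigenvector h1
    exact hc (h w w.2 (fun h0 => hw.2 (Subtype.ext h0)) c (congrArg Subtype.val hw.apply_eq_smul))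
  have htop : T'.maxGenEigenspace c₀ = ⊤ := by
    rw [← Module.End.iSup_maxGenEigenspace_eq_top T']
    refine le_antisymm (le_iSup _ c₀) (iSup_le fun c => ?_)
    by_cases hc : c = c₀
    · rw [hc]
    · rw [hbot c hc]; exact bot_le
  rw [Module.End.maxGenEigenspace_eq_genEigenspace_finrank, Module.End.genEigenspace_restrict]
    at htop
  refine ⟨Module.finrank F E, fun v hv => ?_⟩
  have : (⟨v, hv⟩ : E) ∈ (⊤ : Submodule F E) := trivial
  rw [← htop, Submodule.mem_comap, Module.End.mem_genEigenspace_nat] at this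
  exact this

end Generalized

namespace IsGradedRep

variable {F : Type*} [Field F] {V : Type*} [AddCommGroup V] [Module F V]
variable {𝒱 : ℤ → Submodule F V} {ψ : ℤ → F[X] →ₗ[F] Module.End F V}

variable [IsAlgClosed F] (hψ : IsGradedRep 𝒱 ψ) (hfin : ∀ k, FiniteDimensional F (𝒱 k)) {a : F}
  (hw : ∀ k, ∀ l ∈ weights 𝒱 ψ k, l = leval (a + k))
include hψ hfin hw

/-- The eigenspace of one `g(D)` is stable under all the others, so it contains a joint eigenvector,
whose weight is known. -/
theorem eigenvalue_eq_eval (g : F[X]) {k : ℤ} {v : V} (hv : v ∈ 𝒱 k) (hv0 : v ≠ 0) {c : F}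
    (hvc : ψ 0 g v = c • v) : c = g.eval (a + k) := by
  obtain ⟨l, w, hwE, hw0, hwl⟩ := hψ.exists_weight_of_le (k := k) (𝒱 k ⊓ (ψ 0 g).eigenspace c)
    inf_le_left ((Submodule.ne_bot_iff _).mpr
      ⟨v, ⟨hv, Module.End.mem_eigenspace_iff.mpr hvc⟩, hv0⟩) (fun f u hu =>
        ⟨hψ.mem_zero f hu.1, Module.End.mem_eigenspace_iff.mpr (by
          rw [hψ.comm_zero, Module.End.mem_eigenspace_iff.mp hu.2, map_smul])⟩)
  have h1 := hw k l ⟨w, hwE.1, hw0, hwl⟩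
  have h2 := (Module.End.mem_eigenspace_iff.mp hwE.2).symm.trans (hwl g)
  rw [smul_left_injective F hw0 h2, h1, leval_apply]

theorem exists_pow_sub_eval_eq_zero (g : F[X]) (k : ℤ) :
    ∃ M : ℕ, ∀ v ∈ 𝒱 k, ((ψ 0 g - g.eval (a + k) • 1) ^ M) v = 0 :=
  exists_pow_sub_smul_eq_zero _ _ (fun _ hv => hψ.mem_zero g hv) _
    fun _ hv hv0 _ => hψ.eigenvalue_eq_eval hfin hw g hv hv0

/-- With `g(X + α) - g(X) = X - (a + k)`, the operator `g(D)` has the same single eigenvalue in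
degrees `k` and `k + α`. Its nilpotent part `Z` satisfies `[Z, t^α f(D)] = t^α (X - (a + k)) f`. -/
theorem exists_pow_kills_of_ne_zero [CharZero F] (k : ℤ) {α : ℤ} (hα : α ≠ 0) :
    ∃ M : ℕ, ∀ v ∈ 𝒱 k, ∀ f, ψ α ((X - C (a + k)) ^ M * f) v = 0 := by
  set ℓ : F[X] := X - C (a + k)
  obtain ⟨g, hg⟩ := exists_taylor_sub_eq (Int.cast_ne_zero.mpr hα : (α : F) ≠ 0) ℓ
  have hgk : g.eval (a + (k + α : ℤ)) = g.eval (a + k) := by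
    have := congrArg (eval (a + (k : F))) hg
    rw [eval_sub, taylor_eval, eval_sub, eval_X, eval_C, sub_self, sub_eq_zero] at this
    rw [← this]; push_cast; rw [add_assoc]
  set Z : Module.End F V := ψ 0 g - g.eval (a + k) • 1
  obtain ⟨i, hi⟩ := hψ.exists_pow_sub_eval_eq_zero hfin hw g k
  obtain ⟨j, hj⟩ := hψ.exists_pow_sub_eval_eq_zero hfin hw g (k + α)
  rw [hgk] at hj
  have hZ : ∀ f v, Z (ψ α f v) = ψ α (ℓ * f) v + ψ α f (Z v) := by
    intro f v
    simp only [Z, LinearMap.sub_apply, LinearMap.smul_apply, Module.End.one_apply]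
    rw [hψ.zero_comp, hg, map_sub, map_smul]
    abel
  have hZk : ∀ v ∈ 𝒱 k, Z v ∈ 𝒱 k := fun v hv =>
    (𝒱 k).sub_mem (hψ.mem_zero g hv) ((𝒱 k).smul_mem _ hv)
  -- Each unit of nilpotency order of `v` costs `j` factors `ℓ`: up to terms already killed,
  -- inserting `ℓ` amounts to applying `Z`, and `Z ^ j = 0` in degree `k + α`.
  have key : ∀ i : ℕ, ∀ v ∈ 𝒱 k, (Z ^ i) v = 0 → ∀ f, ψ α (ℓ ^ (i * j) * f) v = 0 := by
    intro i
    induction i with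
    | zero =>
      intro v _ hv f
      rw [pow_zero, Module.End.one_apply] at hv
      rw [hv, map_zero]
    | succ i ih =>
      intro v hv hvi f
      have h1 : ∀ f, ψ α (ℓ ^ (i * j) * f) (Z v) = 0 := by
        refine ih (Z v) (hZk v hv) ?_
        rw [← hvi, pow_succ, Module.End.mul_apply]
      have h2 : ∀ (n : ℕ) f, ψ α (ℓ ^ (i * j) * (ℓ ^ n * f)) v =
          (Z ^ n) (ψ α (ℓ ^ (i * j) * f) v) := by
        intro n
        induction n with
        | zero => intro f; simp
        | succ n ihn =>
          intro f
          rw [pow_succ, mul_assoc, ihn, pow_succ, Module.End.mul_apply, hZ, h1, add_zero,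
            mul_left_comm]
      rw [add_mul, one_mul, pow_add, mul_assoc, h2]
      exact hj _ (hψ.mem _ _ _ _ hv)
  exact ⟨i * j, fun v hv => key i v hv (hi v hv)⟩

/-- In degree zero `Z` gives nothing, since `f(D)` and `g(D)` commute. Instead the annihilators for
`±n` confine the support of `Φ - Φ ∘ taylor n` to `{x, x + n}`, so `Φ` has finite support; varying
`n` leaves only `x`. -/
theorem exists_pow_kills_zero [CharZero F] (k : ℤ) :
    ∃ M : ℕ, ∀ v ∈ 𝒱 k, ∀ f, ψ 0 ((X - C (a + k)) ^ M * f) v = 0 := by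
  classical
  set x : F := a + k
  obtain ⟨Φ, hΦ⟩ : ∃ Φ : F[X] →ₗ[F] (𝒱 k →ₗ[F] V), ∀ f (v : 𝒱 k), Φ f v = ψ 0 f v :=
    ⟨(LinearMap.lcomp F V (𝒱 k).subtype).comp (ψ 0), fun f v => rfl⟩
  have hn : ∀ n : ℕ, n ≠ 0 → ∃ p : F[X], p ≠ 0 ∧ (∀ z, p.eval z = 0 → z = x ∨ z = x + n) ∧
      Kills p (Φ - Φ.comp (taylor (n : F))) := by
    intro n hn
    obtain ⟨i, hi⟩ := hψ.exists_pow_kills_of_ne_zero hfin hw k (α := n) (by omega)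
    obtain ⟨j, hj⟩ := hψ.exists_pow_kills_of_ne_zero hfin hw k (α := -n) (by omega)
    refine ⟨taylor (-(n : F)) ((X - C x) ^ i) * (X - C x) ^ j, mul_ne_zero ?_
      (pow_ne_zero _ (X_sub_C_ne_zero _)), fun z hz => ?_, fun h => LinearMap.ext fun v => ?_⟩
    · rw [Ne, taylor_eq_zero]
      exact pow_ne_zero _ (X_sub_C_ne_zero _)
    · rw [eval_mul, taylor_eval, eval_pow, eval_pow, eval_sub, eval_X, eval_C, eval_sub, eval_X,
        eval_C, mul_eq_zero] at hz
      rcases hz with hz | hz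
      · right
        linear_combination eq_zero_of_pow_eq_zero hz
      · left
        linear_combination eq_zero_of_pow_eq_zero hz
    · have h1 := hψ.eq_taylor_of_apply_eq_zero (α := n) (f := (X - C x) ^ i * 1)
        (g := (X - C x) ^ j * h) (hi v v.2 1) (hj v v.2 h)
      rw [mul_one, Int.cast_natCast, ← mul_assoc] at h1
      rw [LinearMap.sub_apply, LinearMap.comp_apply, LinearMap.sub_apply, hΦ, hΦ, h1, sub_self,
        LinearMap.zero_apply]
  obtain ⟨q, hq, hqΦ⟩ : ∃ q, q ≠ 0 ∧ Kills q Φ := by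
    refine exists_kills_of_forall_sub_taylor 2 fun n hn0 => ?_
    obtain ⟨p, hp, hpz, hk⟩ := hn n hn0
    refine ⟨p, hp, ?_, hk⟩
    refine (Finset.card_le_card (t := {x, x + (n : F)}) fun z hz => ?_).trans Finset.card_le_two
    rw [Multiset.mem_toFinset, mem_roots hp] at hz
    simpa using hpz z hz
  have hsupp : ∀ z, InSupport z Φ → z = x := by
    intro z hz
    obtain ⟨A, hA⟩ := exists_nat_forall_eval_ne_zero (R := q * (X - C x))
      (mul_ne_zero hq (X_sub_C_ne_zero _)) z (neg_ne_zero.mpr one_ne_zero)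
    have h1 := hA (A + 1) (by omega)
    rw [neg_one_mul, ← sub_eq_add_neg, eval_mul, eval_sub, eval_X, eval_C] at h1
    obtain ⟨p, hp, hpz, hk⟩ := hn (A + 1) (by omega)
    rcases hpz z (hz.sub_comp_taylor hqΦ (left_ne_zero_of_mul h1) p hk) with h | h
    · exact h
    · exact absurd (by rw [h]; ring) (right_ne_zero_of_mul h1)
  -- The power of `X - x` in `q` suffices: a support point of the remaining functional would have to
  -- be `x`, yet `w` kills it and `w(x) ≠ 0`.
  obtain ⟨w, hqw, hwx⟩ := exists_eq_pow_rootMultiplicity_mul_and_not_dvd q hq x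
  set m := q.rootMultiplicity x
  set Φ' : F[X] →ₗ[F] (𝒱 k →ₗ[F] V) := Φ.comp (LinearMap.mulLeft F ((X - C x) ^ m))
  have hΦ' : Φ' = 0 := by
    by_contra hne
    obtain ⟨z, hz⟩ := exists_inSupport hne
    have h1 : Kills w Φ' := fun h => by
      change Φ ((X - C x) ^ m * (w * h)) = 0
      rw [← mul_assoc, ← hqw]
      exact hqΦ h
    have h2 : z = x := hsupp z fun p hp => hz p fun h => by
      change Φ ((X - C x) ^ m * (p * h)) = 0
      rw [mul_left_comm]
      exact hp _
    exact hwx (dvd_iff_isRoot.mpr (h2 ▸ hz w h1))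
  exact ⟨m, fun v hv f => (hΦ _ ⟨v, hv⟩).symm.trans
    (LinearMap.congr_fun (LinearMap.congr_fun hΦ' f) ⟨v, hv⟩)⟩

theorem exists_pow_kills [CharZero F] (k α : ℤ) :
    ∃ M : ℕ, ∀ v ∈ 𝒱 k, ∀ f, ψ α ((X - C (a + k)) ^ M * f) v = 0 := by
  by_cases hα : α = 0
  · subst hα
    exact hψ.exists_pow_kills_zero hfin hw k
  · exact hψ.exists_pow_kills_of_ne_zero hfin hw k hα

/-- The defect `G` of associativity is unchanged, by the commutator relation, when both products are
reversed. One form is killed by a power of `X - (a + k)`, the other by a power of `X - (a + k + γ)`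
with `γ` the nonzero degree among `α`, `β`; these are coprime, so `G = 0`. -/
theorem comp_of_ne_zero [CharZero F] {k α β : ℤ} (hαβ : α ≠ 0 ∨ β ≠ 0) (f g : F[X]) {v : V}
    (hv : v ∈ 𝒱 k) : ψ α f (ψ β g v) = ψ (α + β) (taylor (β : F) f * g) v := by
  obtain ⟨n, hn⟩ := hψ.exists_pow_kills hfin hw k (α + β)
  obtain ⟨n₁, hn₁⟩ := hψ.exists_pow_kills hfin hw k β
  obtain ⟨n₂, hn₂⟩ := hψ.exists_pow_kills hfin hw (k + β) α
  obtain ⟨n₃, hn₃⟩ := hψ.exists_pow_kills hfin hw k α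
  obtain ⟨n₄, hn₄⟩ := hψ.exists_pow_kills hfin hw (k + α) β
  have htaylor : ∀ (γ : ℤ) (i : ℕ),
      taylor (γ : F) ((X - C (a + (k + γ : ℤ))) ^ i) = (X - C (a + k)) ^ i := by
    intro γ i
    rw [taylor_pow, map_sub, taylor_X, taylor_C]
    congr 1
    push_cast
    simp only [C_add]
    ring
  have hcop : ∀ (γ : ℤ) (i j : ℕ), γ ≠ 0 →
      IsCoprime ((X - C (a + (k + γ : ℤ))) ^ i : F[X]) ((X - C (a + (k : F))) ^ j) := by
    intro γ i j hγ
    refine (isCoprime_X_sub_C_of_isUnit_sub (isUnit_iff_ne_zero.mpr ?_)).pow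
    push_cast
    rw [show a + ((k : F) + γ) - (a + k) = γ by ring]
    exact Int.cast_ne_zero.mpr hγ
  have hcomm := fun f g => hψ.comm α β f g v
  simp only [map_sub, LinearMap.sub_apply] at hcomm
  by_cases hβ : β = 0
  · have hα : α ≠ 0 := hαβ.resolve_right fun h => h hβ
    let G : F[X] →ₗ[F] V := ((ψ α f).comp ((ψ β : F[X] →ₗ[F] V →ₗ[F] V).flip v)) -
      ((ψ (α + β) : F[X] →ₗ[F] V →ₗ[F] V).flip v).comp (LinearMap.mulLeft F (taylor (β : F) f))
    have hG : ∀ g, G g = ψ α f (ψ β g v) - ψ (α + β) (taylor (β : F) f * g) v := fun g => rfl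
    have hG' : ∀ g, G g = ψ β g (ψ α f v) - ψ (α + β) (f * taylor (α : F) g) v := fun g => by
      rw [hG, sub_eq_sub_iff_sub_eq_sub, hcomm]
    have h0 : G = 0 := by
      refine Kills.eq_zero_of_isCoprime (p := (X - C (a + (k + α : ℤ))) ^ (n₄ + n))
        (q := (X - C (a + k)) ^ (n₁ + n)) (fun h => ?_) (fun h => ?_) (hcop α _ _ hα)
      · rw [hG', taylor_mul, htaylor, pow_add, pow_add, mul_assoc,
          hn₄ _ (hψ.mem _ _ _ _ hv), show ∀ s t u : F[X], f * (s * t * u) = t * (f * s * u) by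
            intros; ring, hn v hv, sub_zero]
      · rw [hG, pow_add, mul_assoc, hn₁ v hv, map_zero,
          show ∀ r s t u : F[X], r * (s * (t * u)) = t * (r * s * u) by intros; ring,
          hn v hv, sub_zero]
    rw [← sub_eq_zero, ← hG, h0, LinearMap.zero_apply]
  · let G : F[X] →ₗ[F] V := ((ψ α : F[X] →ₗ[F] V →ₗ[F] V).flip (ψ β g v)) -
      ((ψ (α + β) : F[X] →ₗ[F] V →ₗ[F] V).flip v).comp
        ((LinearMap.mulRight F g).comp (taylor (β : F)))
    have hG : ∀ f, G f = ψ α f (ψ β g v) - ψ (α + β) (taylor (β : F) f * g) v := fun g => rfl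
    have hG' : ∀ f, G f = ψ β g (ψ α f v) - ψ (α + β) (f * taylor (α : F) g) v := fun f => by
      rw [hG, sub_eq_sub_iff_sub_eq_sub, hcomm]
    have h0 : G = 0 := by
      refine Kills.eq_zero_of_isCoprime (p := (X - C (a + (k + β : ℤ))) ^ (n₂ + n))
        (q := (X - C (a + k)) ^ (n₃ + n)) (fun h => ?_) (fun h => ?_) (hcop β _ _ hβ)
      · rw [hG, taylor_mul, htaylor, pow_add, pow_add, mul_assoc,
          hn₂ _ (hψ.mem _ _ _ _ hv), show ∀ s t u : F[X], s * t * u * g = t * (s * u * g) by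
            intros; ring, hn v hv, sub_zero]
      · rw [hG', pow_add, mul_assoc, hn₃ v hv, map_zero,
          show ∀ r s t u : F[X], s * (t * u) * r = t * (r * s * u) by intros; ring,
          hn v hv, sub_zero]
    rw [← sub_eq_zero, ← hG, h0, LinearMap.zero_apply]

theorem comp_eq [CharZero F] {k : ℤ} (α β : ℤ) (f g : F[X]) {v : V}
    (hv : v ∈ 𝒱 k) : ψ α f (ψ β g v) = ψ (α + β) (taylor (β : F) f * g) v := by
  by_cases hαβ : α ≠ 0 ∨ β ≠ 0
  · exact hψ.comp_of_ne_zero hfin hw hαβ f g hv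
  · push Not at hαβ
    obtain ⟨rfl, rfl⟩ := hαβ
    -- Factoring `g(D)` as `t` times `t^(-1) g(D)` reduces the remaining case to products with a
    -- factor of nonzero degree.
    have h1 : ψ 0 g v = ψ 1 1 (ψ (-1) g v) := by
      rw [hψ.comp_of_ne_zero hfin hw (Or.inl one_ne_zero) _ _ hv]
      simp
    rw [h1, hψ.comp_of_ne_zero hfin hw (Or.inr one_ne_zero) _ _ (hψ.mem _ _ _ _ hv),
      hψ.comp_of_ne_zero hfin hw (Or.inl (by norm_num)) _ _ hv, mul_one, taylor_taylor]
    simp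

/-- `1` acts as an idempotent whose only eigenvalue is `1`. -/
theorem one_apply [CharZero F] {k : ℤ} {v : V} (hv : v ∈ 𝒱 k) : ψ 0 1 v = v := by
  have h0 : ψ 0 1 (ψ 0 1 v - v) = 0 • (ψ 0 1 v - v) := by
    rw [map_sub, hψ.comp_eq hfin hw 0 0 1 1 hv]
    simp
  by_contra hne
  have := hψ.eigenvalue_eq_eval hfin hw 1 ((𝒱 k).sub_mem (hψ.mem_zero 1 hv) hv)
    (sub_ne_zero.mpr hne) (c := 0) (by rw [h0, zero_smul, zero_smul])
  simp at this

end IsGradedRep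

/-! ### The isomorphism with `A_{p,G}` -/

section Internal

variable {F : Type*} [Field F] {V : Type*} [AddCommGroup V] [Module F V]
  {M : Type*} [AddCommGroup M] [Module F M] {𝒱 : ℤ → Submodule F V}

theorem exists_linearMap_of_isInternal (h : DirectSum.IsInternal 𝒱) (φ : ∀ k, 𝒱 k →ₗ[F] M) :
    ∃ Φ : V →ₗ[F] M, ∀ k v (hv : v ∈ 𝒱 k), Φ v = φ k ⟨v, hv⟩ := by
  let e := LinearEquiv.ofBijective (DirectSum.coeLinearMap 𝒱) h
  refine ⟨(DirectSum.toModule F ℤ M φ).comp e.symm.toLinearMap, fun k v hv => ?_⟩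
  have : e.symm v = DirectSum.lof F ℤ (fun k => 𝒱 k) k ⟨v, hv⟩ := by
    rw [LinearEquiv.symm_apply_eq]
    exact (DirectSum.coeLinearMap_lof 𝒱 k ⟨v, hv⟩).symm
  rw [LinearMap.comp_apply, LinearEquiv.coe_coe, this, DirectSum.toModule_lof]

theorem linearMap_eq_of_isInternal (h : DirectSum.IsInternal 𝒱) {Φ Ψ : V →ₗ[F] M}
    (hΦ : ∀ k, ∀ v ∈ 𝒱 k, Φ v = Ψ v) : Φ = Ψ := by
  refine LinearMap.ext fun v => ?_
  have hv : v ∈ ⨆ k, 𝒱 k := h.submodule_iSup_eq_top ▸ Submodule.mem_top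
  have : ⨆ k, 𝒱 k ≤ LinearMap.eqLocus Φ Ψ := iSup_le fun k v hv => hΦ k v hv
  exact this hv

theorem exists_ne_bot_of_isInternal [Nontrivial V] (h : DirectSum.IsInternal 𝒱) :
    ∃ k, 𝒱 k ≠ ⊥ := by
  by_contra! hcon
  have : ⨆ k, 𝒱 k = ⊤ := h.submodule_iSup_eq_top
  rw [iSup_congr hcon, iSup_bot] at this
  exact bot_ne_top this

end Internal

namespace IsGradedRep

variable {F : Type*} [Field F] {V : Type*} [AddCommGroup V] [Module F V]
variable {𝒱 : ℤ → Submodule F V} {ψ : ℤ → F[X] →ₗ[F] Module.End F V}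

/-- `t^k` maps degree `0` onto degree `k` with inverse `t^(-k)`; transporting everything to degree
`0`, the action is determined by `D` there. -/
theorem exists_equiv_actA [IsAlgClosed F] [CharZero F] [Nontrivial V] (hψ : IsGradedRep 𝒱 ψ)
    (hint : DirectSum.IsInternal 𝒱) (hfin : ∀ k, FiniteDimensional F (𝒱 k)) {a : F}
    (hw : ∀ k, ∀ l ∈ weights 𝒱 ψ k, l = leval (a + k)) :
    ∃ (p : ℕ) (G : Matrix (Fin p) (Fin p) F) (e : V ≃ₗ[F] YSpace F p), 1 ≤ p ∧
      (∀ α f v, e (ψ α f v) = actA G (W.tf α f) (e v)) ∧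
      ∀ k v, v ∈ 𝒱 k ↔ e v ∈ LinearMap.range (YSpace.Y (F := F) (p := p) k) := by
  set p := Module.finrank F (𝒱 0)
  let b : 𝒱 0 ≃ₗ[F] (Fin p → F) := (Module.finBasis F (𝒱 0)).equivFun
  let D : 𝒱 0 →ₗ[F] 𝒱 0 := (ψ 0 X).restrict fun v hv => hψ.mem_zero X hv
  set G : Matrix (Fin p) (Fin p) F := LinearMap.toMatrix' (b.toLinearMap ∘ₗ D ∘ₗ b.symm.toLinearMap)
  have hG : ∀ v, ((b.symm (G.mulVec v) : 𝒱 0) : V) = ψ 0 X (b.symm v : 𝒱 0) := by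
    intro v
    rw [← Matrix.toLin'_apply, Matrix.toLin'_toMatrix']
    simp [D]
  have haeval : ∀ f v, ((b.symm ((aeval G f).mulVec v) : 𝒱 0) : V) = ψ 0 f (b.symm v : 𝒱 0) := by
    intro f
    induction f using Polynomial.induction_on with
    | C c =>
      intro v
      rw [aeval_C, Algebra.algebraMap_eq_smul_one, Matrix.smul_mulVec, Matrix.one_mulVec,
        ← mul_one (C c), ← smul_eq_C_mul, map_smul, map_smul, LinearMap.smul_apply,
        hψ.one_apply hfin hw (b.symm v).2]
      rfl
    | add f g hf hg =>
      intro v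
      rw [map_add, Matrix.add_mulVec, map_add, map_add, LinearMap.add_apply, ← hf, ← hg]
      rfl
    | monomial n c ih =>
      intro v
      rw [pow_succ, ← mul_assoc, map_mul, ← Matrix.mulVec_mulVec, ih, aeval_X, hG,
        hψ.comp_eq hfin hw 0 0 _ _ (b.symm v).2]
      simp
  have hinv : ∀ k, ∀ v ∈ 𝒱 k, ∀ j, ψ (-j) 1 (ψ j 1 v) = v := by
    intro k v hv j
    rw [hψ.comp_eq hfin hw _ _ _ _ hv]
    simpa using hψ.one_apply hfin hw hv
  have hinv' : ∀ k, ∀ v ∈ 𝒱 k, ∀ j, ψ j 1 (ψ (-j) 1 v) = v := by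
    intro k v hv j
    rw [hψ.comp_eq hfin hw _ _ _ _ hv]
    simpa using hψ.one_apply hfin hw hv
  have hmem : ∀ k, ∀ v ∈ 𝒱 k, ψ (-k) 1 v ∈ 𝒱 0 := fun k v hv => by
    simpa using hψ.mem (-k) 1 k v hv
  obtain ⟨E, hE⟩ := exists_linearMap_of_isInternal hint fun k =>
    (YSpace.Y (F := F) (p := p) k).comp
      (b.toLinearMap.comp (((ψ (-k) 1).comp (𝒱 k).subtype).codRestrict (𝒱 0) fun v =>
        hmem k v v.2))
  have hE' : ∀ k v (hv : v ∈ 𝒱 k), E v = YSpace.Y k (b ⟨ψ (-k) 1 v, hmem k v hv⟩) := hE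
  let E' : YSpace F p →ₗ[F] V := YSpace.lift fun k =>
    (ψ k 1).comp ((𝒱 0).subtype.comp b.symm.toLinearMap)
  have hEY : ∀ k v, E' (YSpace.Y k v) = ψ k 1 (b.symm v : 𝒱 0) := fun k v => by
    simp [E', YSpace.lift_Y]
  have hmem' : ∀ k v, E' (YSpace.Y k v) ∈ 𝒱 k := fun k v => by
    rw [hEY]
    simpa using hψ.mem k 1 0 _ (b.symm v).2
  have h1 : E.comp E' = LinearMap.id := by
    refine YSpace.ext_hom fun k v => ?_
    rw [LinearMap.comp_apply, hE' k _ (hmem' k v), LinearMap.id_apply]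
    congr 1
    rw [← LinearEquiv.eq_symm_apply]
    refine Subtype.ext ?_
    change ψ (-k) 1 (E' (YSpace.Y k v)) = _
    rw [hEY, hinv 0 _ (b.symm v).2]
  have h2 : E'.comp E = LinearMap.id := by
    refine linearMap_eq_of_isInternal hint fun k v hv => ?_
    rw [LinearMap.comp_apply, hE' k v hv, hEY, LinearEquiv.symm_apply_apply, hinv' k v hv,
      LinearMap.id_apply]
  let e : V ≃ₗ[F] YSpace F p := LinearEquiv.ofLinearMap E E' h1 h2
  have he : ∀ v, e v = E v := fun v => rfl
  have hEE : ∀ y, E (E' y) = y := fun y => LinearMap.congr_fun h1 y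
  have hEE' : ∀ v, E' (E v) = v := fun v => LinearMap.congr_fun h2 v
  refine ⟨p, G, e, ?_, fun α f => ?_, fun k v => ⟨fun hv => ?_, ?_⟩⟩
  · obtain ⟨k, hk⟩ := exists_ne_bot_of_isInternal hint
    obtain ⟨v, hv, hv0⟩ := (Submodule.ne_bot_iff _).mp hk
    have : Nontrivial (𝒱 0) := ⟨⟨⟨ψ (-k) 1 v, hmem k v hv⟩, 0, fun h => hv0 (by
      have h' : ψ (-k) 1 v = 0 := congrArg Subtype.val h
      rw [← hinv' k v hv k, h', map_zero])⟩⟩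
    exact Module.finrank_pos
  · have h3 : E'.comp (actA G (W.tf α f)) = (ψ α f).comp E' := by
      refine YSpace.ext_hom fun k v => ?_
      rw [LinearMap.comp_apply, LinearMap.comp_apply, actA_tf, hEY, hEY, ← aeval_taylor, haeval,
        hψ.comp_eq hfin hw _ _ _ _ (b.symm v).2, hψ.comp_eq hfin hw _ _ _ _ (b.symm v).2]
      simp
    intro v
    have := LinearMap.congr_fun h3 (E v)
    rw [LinearMap.comp_apply, LinearMap.comp_apply, hEE'] at this
    rw [he, he, ← this, hEE]
  · exact ⟨_, (hE' k v hv).symm⟩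
  · rintro ⟨u, hu⟩
    rw [he] at hu
    rw [← hEE' v, ← hu]
    exact hmem' k u

end IsGradedRep

/-! ### The twist by the anti-automorphism `t ↦ t`, `D ↦ -D` -/

section Twist

variable {F : Type*} [Field F]

/-- The map `f(D) ↦ f(-(D + α))`. -/
noncomputable def reflect (α : ℤ) : F[X] →ₗ[F] F[X] := (aeval (-(X + C (α : F)))).toLinearMap

theorem eval_reflect (α : ℤ) (f : F[X]) (x : F) :
    (reflect α f).eval x = f.eval (-(x + α)) := by
  change (f.comp (-(X + C (α : F)))).eval x = _
  rw [eval_comp]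
  simp

theorem reflect_mul (α : ℤ) (f g : F[X]) : reflect α (f * g) = reflect α f * reflect α g :=
  map_mul (aeval (-(X + C (α : F)))) f g

theorem actB_eq_neg_actA {p : ℕ} (G : Matrix (Fin p) (Fin p) F) (α : ℤ) (f : F[X])
    (y : YSpace F p) : actB G (W.tf α f) y = -actA G (W.tf α (reflect α f)) y := by
  have : actB G (W.tf α f) = -actA G (W.tf α (reflect α f)) := by
    refine YSpace.ext_hom fun β v => ?_
    have hA : aeval ((β : F) • (1 : Matrix (Fin p) (Fin p) F) + G) (reflect α f) =
        aeval (-(((α + β : ℤ) : F) • (1 : Matrix (Fin p) (Fin p) F) + G)) f := by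
      rw [show reflect α f = aeval (-(X + C (α : F))) f from rfl, ← aeval_algHom_apply]
      congr 2
      simp only [map_neg, map_add, aeval_X, aeval_C, Algebra.algebraMap_eq_smul_one]
      push_cast
      module
    rw [actB_tf, LinearMap.neg_apply, actA_tf, hA]
  rw [this, LinearMap.neg_apply]

variable {V : Type*} [AddCommGroup V] [Module F V]

/-- The twisted representation. -/
noncomputable def twist (ψ : ℤ → F[X] →ₗ[F] Module.End F V) (α : ℤ) : F[X] →ₗ[F] Module.End F V :=
  -(ψ α).comp (reflect α)

theorem twist_apply (ψ : ℤ → F[X] →ₗ[F] Module.End F V) (α : ℤ) (f : F[X]) (v : V) :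
    twist ψ α f v = -ψ α (reflect α f) v := rfl

variable [CharZero F]

theorem taylor_reflect (α β : ℤ) (f : F[X]) :
    taylor (β : F) (reflect α f) = reflect (α + β) f :=
  funext fun x => by
    rw [taylor_eval, eval_reflect, eval_reflect]
    push_cast
    congr 1
    ring

theorem reflect_taylor (α β : ℤ) (f : F[X]) :
    reflect (α + β) (taylor (β : F) f) = reflect α f :=
  funext fun x => by
    rw [eval_reflect, taylor_eval, eval_reflect]
    push_cast
    congr 1
    ring

theorem reflect_reflect (α : ℤ) (f : F[X]) : reflect α (reflect α f) = f :=
  funext fun x => by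
    rw [eval_reflect, eval_reflect]
    congr 1
    ring

/-- An anti-automorphism with a minus sign preserves commutators, so the twist is again a
representation of the Lie algebra, though associativity is not preserved. -/
theorem IsGradedRep.twist {𝒱 : ℤ → Submodule F V} {ψ : ℤ → F[X] →ₗ[F] Module.End F V}
    (hψ : IsGradedRep 𝒱 ψ) : IsGradedRep 𝒱 (twist ψ) where
  comm α β f g v := by
    simp only [twist_apply, map_neg, neg_neg]
    rw [hψ.comm, map_sub (reflect (α + β)), reflect_mul, reflect_mul, reflect_taylor,
      taylor_reflect, taylor_reflect, ← LinearMap.neg_apply, ← map_neg, neg_sub,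
      add_comm β α]
    congr 3
    rw [add_comm α β, reflect_taylor]
  mem α f k v hv := (𝒱 _).neg_mem (hψ.mem α _ k v hv)

theorem weights_twist {𝒱 : ℤ → Submodule F V} {ψ : ℤ → F[X] →ₗ[F] Module.End F V} {k : ℤ}
    {l : F[X] →ₗ[F] F} (hl : l ∈ weights 𝒱 (twist ψ) k) :
    -l.comp (reflect 0) ∈ weights 𝒱 ψ k := by
  obtain ⟨v, hv, hv0, hvl⟩ := hl
  refine ⟨v, hv, hv0, fun g => ?_⟩
  have := hvl (reflect 0 g)
  rw [twist_apply, reflect_reflect] at this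
  rw [LinearMap.neg_apply, LinearMap.comp_apply, neg_smul, ← this, neg_neg]

end Twist

/-! ### Graded endomorphisms of indecomposable modules -/

section Indecomposable

variable {F : Type*} [Field F] {V : Type*} [AddCommGroup V] [Module F V]

theorem le_iSup_maxGenEigenspace_inf [IsAlgClosed F] (T : Module.End F V) (E : Submodule F V)
    [FiniteDimensional F E] (hT : ∀ v ∈ E, T v ∈ E) : E ≤ ⨆ c, T.maxGenEigenspace c ⊓ E := by
  let T' : Module.End F E := T.restrict hT
  have h := congrArg (Submodule.map E.subtype) (Module.End.iSup_maxGenEigenspace_eq_top T')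
  rw [Submodule.map_subtype_top, Submodule.map_iSup] at h
  refine h.symm.le.trans (iSup_mono fun c => ?_)
  have h2 : T'.maxGenEigenspace c = (T.maxGenEigenspace c).comap E.subtype :=
    Module.End.genEigenspace_restrict T E ⊤ c hT
  rw [h2, Submodule.map_comap_subtype, inf_comm]

variable [LieRingModule (W F) V] [LieModule F (W F) V] {𝒱 : ℤ → Submodule F V}

/-- The generalized eigenspaces of a degree-preserving endomorphism are submodules; the one for `c₀`
and the sum of the others split `V`. -/
theorem exists_forall_eigenvalue_eq [IsAlgClosed F] (hq : IsQuasifinite 𝒱)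
    (hindec : IsIndecomposable 𝒱) (T : Module.End F V) (hT : ∀ k, ∀ v ∈ 𝒱 k, T v ∈ 𝒱 k)
    (hcomm : ∀ (x : W F) (v : V), T ⁅x, v⁆ = ⁅x, T v⁆) :
    ∃ c₀ : F, ∀ v, v ≠ 0 → ∀ c, T v = c • v → c = c₀ := by
  have := hindec.nontrivial
  have := hq.finiteDimensional
  obtain ⟨k₀, hk₀⟩ := exists_ne_bot_of_isInternal hq.isInternal
  have : Nontrivial (𝒱 k₀) := Submodule.nontrivial_iff_ne_bot.mpr hk₀
  obtain ⟨c₀, hc₀⟩ := Module.End.exists_eigenvalue (T.restrict (hT k₀))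
  obtain ⟨w, hw⟩ := hc₀.exists_hasEigenvector
  have hTw : T w = c₀ • (w : V) := congrArg Subtype.val hw.apply_eq_smul
  have hw0 : (w : V) ≠ 0 := fun h => hw.2 (Subtype.ext h)
  have mem_of_eigen : ∀ v c, T v = c • v → v ∈ T.maxGenEigenspace c := fun v c h =>
    Module.End.genEigenspace_le_maximal _ _ 1 (Module.End.mem_eigenspace_iff.mpr h)
  have hlie : ∀ (x : W F) c, T.maxGenEigenspace c ≤
      (T.maxGenEigenspace c).comap (LieModule.toEnd F (W F) V x) := fun x c =>
    Module.End.mapsTo_maxGenEigenspace_of_comm (LinearMap.ext fun v => hcomm x v) c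
  let M : LieSubmodule F (W F) V :=
    { T.maxGenEigenspace c₀ with lie_mem := fun {x} _ hv => hlie x c₀ hv }
  let M' : LieSubmodule F (W F) V :=
    { (⨆ c, ⨆ (_ : c ≠ c₀), T.maxGenEigenspace c : Submodule F V) with
      lie_mem := fun {x v} hv => by
        have : (⨆ c, ⨆ (_ : c ≠ c₀), T.maxGenEigenspace c : Submodule F V) ≤
            (⨆ c, ⨆ (_ : c ≠ c₀), T.maxGenEigenspace c).comap (LieModule.toEnd F (W F) V x) :=
          iSup₂_le fun c hc => (hlie x c).trans
            (Submodule.comap_mono (le_iSup₂_of_le c hc le_rfl))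
        exact this hv }
  have hdisj : Disjoint M.toSubmodule M'.toSubmodule := T.independent_maxGenEigenspace c₀
  have hle : ∀ k, 𝒱 k ≤ (M.toSubmodule ⊓ 𝒱 k) ⊔ (M'.toSubmodule ⊓ 𝒱 k) := by
    intro k
    refine (le_iSup_maxGenEigenspace_inf T (𝒱 k) (hT k)).trans (iSup_le fun c => ?_)
    by_cases hc : c = c₀
    · rw [hc]
      exact le_sup_left
    · refine le_trans (inf_le_inf_right _ ?_) le_sup_right
      exact le_iSup₂_of_le c hc le_rfl
  set A := ⨆ k, M.toSubmodule ⊓ 𝒱 k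
  set A' := ⨆ k, M'.toSubmodule ⊓ 𝒱 k
  have hA : A ≤ M.toSubmodule := iSup_le fun k => inf_le_left
  have hA' : A' ≤ M'.toSubmodule := iSup_le fun k => inf_le_left
  have htop : A ⊔ A' = ⊤ := by
    rw [eq_top_iff, ← hq.isInternal.submodule_iSup_eq_top]
    exact iSup_le fun k => (hle k).trans (sup_le_sup (le_iSup (fun k => M.toSubmodule ⊓ 𝒱 k) k)
      (le_iSup (fun k => M'.toSubmodule ⊓ 𝒱 k) k))
  -- The homogeneous parts `A ≤ M` and `A' ≤ M'` already span `V`, so by disjointness they are all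
  -- of `M` and `M'`; this gives gradedness.
  have hgr : ∀ {P P' B B' : Submodule F V}, Disjoint P P' → B ≤ P → B' ≤ P' → B ⊔ B' = ⊤ →
      P = B := by
    intro P P' B B' hd hB hB' ht
    refine le_antisymm (fun v hv => ?_) hB
    obtain ⟨x, hx, y, hy, rfl⟩ := Submodule.mem_sup.mp (ht ▸ Submodule.mem_top : v ∈ B ⊔ B')
    have : y = 0 := Submodule.disjoint_def.mp hd y
      ((P.add_mem_iff_right (hB hx)).mp hv) (hB' hy)
    rwa [this, add_zero]
  have hcompl : IsCompl M M' := by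
    rw [← LieSubmodule.isCompl_toSubmodule]
    exact ⟨hdisj, codisjoint_iff.mpr (eq_top_iff.mpr (htop ▸ sup_le_sup hA hA'))⟩
  rcases hindec.eq_bot_or_eq_bot M M' (hgr hdisj hA hA' htop)
    (hgr hdisj.symm hA' hA (sup_comm A A' ▸ htop)) hcompl with h | h
  · have : (w : V) ∈ M := mem_of_eigen _ _ hTw
    rw [h, LieSubmodule.mem_bot] at this
    exact absurd this hw0
  · refine ⟨c₀, fun v hv c hc => ?_⟩
    by_contra hne
    have : v ∈ M' := Submodule.mem_iSup_of_mem c (Submodule.mem_iSup_of_mem hne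
      (mem_of_eigen v c hc))
    rw [h, LieSubmodule.mem_bot] at this
    exact hv this

theorem hasTrivialCompositionFactor_of_lie_eq_zero {k : ℤ} {v : V} (hv : v ∈ 𝒱 k) (hv0 : v ≠ 0)
    (h : ∀ x : W F, ⁅x, v⁆ = 0) : HasTrivialCompositionFactor 𝒱 := by
  have hx : ∀ (x : W F), ∀ u ∈ Submodule.span F {v}, ⁅x, u⁆ = 0 := by
    intro x u hu
    obtain ⟨c, rfl⟩ := Submodule.mem_span_singleton.mp hu
    rw [lie_smul, h, smul_zero]
  let M : LieSubmodule F (W F) V :=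
    { Submodule.span F {v} with
      lie_mem := fun {x u} hu => by
        rw [hx x u hu]
        exact Submodule.zero_mem (Submodule.span F {v}) }
  have hM : M.toSubmodule = Submodule.span F {v} := rfl
  refine ⟨⊥, M, ?_, ?_, bot_covBy_iff.mpr ⟨fun hbot => hv0 ?_, fun N hN => ?_⟩, fun x u hu => ?_⟩
  · simp [IsGradedSubmodule]
  · rw [IsGradedSubmodule, hM]
    refine le_antisymm ?_ (iSup_le fun k => inf_le_left)
    refine le_trans (le_inf le_rfl ?_) (le_iSup (fun k => Submodule.span F {v} ⊓ 𝒱 k) k)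
    rwa [Submodule.span_singleton_le_iff_mem]
  · have : v ∈ M := Submodule.mem_span_singleton_self v
    rwa [hbot, LieSubmodule.mem_bot] at this
  · rw [← LieSubmodule.toSubmodule_eq_bot]
    exact (nonzero_span_atom v hv0).2 _ hN
  · rw [hx x u hu]
    exact LieSubmodule.zero_mem _

end Indecomposable

/-! ### The classification -/

section Classification

variable {F : Type*} [Field F] {V : Type*} [AddCommGroup V] [Module F V]
  [LieRingModule (W F) V] [LieModule F (W F) V] {𝒱 : ℤ → Submodule F V}

variable (F V) in
/-- The operators `t ^ α f(D)` on a `𝒲`-module. -/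
noncomputable def rep (α : ℤ) : F[X] →ₗ[F] Module.End F V :=
  (LieModule.toEnd F (W F) V : W F →ₗ[F] Module.End F V).comp (W.tf α)

theorem rep_apply (α : ℤ) (f : F[X]) (v : V) : rep F V α f v = ⁅W.tf α f, v⁆ := rfl

theorem W.tf_mem_grade (α : ℤ) (f : F[X]) : W.tf α f ∈ W.grade F α := by
  rw [f.as_sum_range_C_mul_X_pow, map_sum]
  refine Submodule.sum_mem _ fun i _ => ?_
  rw [← smul_eq_C_mul, map_smul]
  exact Submodule.smul_mem _ _ (Submodule.subset_span ⟨i, rfl⟩)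

theorem W.lie_eq_of_forall_tf {M : Type*} [AddCommGroup M] [Module F M] {Φ Ψ : W F →ₗ[F] M}
    (h : ∀ α f, Φ (W.tf α f) = Ψ (W.tf α f)) (x : W F) : Φ x = Ψ x :=
  LinearMap.congr_fun (W.ext_hom h) x

theorem IsQuasifinite.isGradedRep (hq : IsQuasifinite 𝒱) : IsGradedRep 𝒱 (rep F V) where
  comm α β f g v := by
    simp only [rep_apply]
    rw [← lie_lie, W.lie_def, W.tf_mul_tf, W.tf_mul_tf, add_comm β α, ← map_sub, mul_comm f]
  mem α f k v hv := add_comm α k ▸ hq.lie_mem α k _ v (W.tf_mem_grade α f) hv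

/-- Both `D` and the degree operator bracket `t^α f(D)` to `α t^α f(D)`, so their difference is a
module endomorphism. -/
theorem exists_forall_weight_apply_X [IsAlgClosed F] (hq : IsQuasifinite 𝒱)
    (hindec : IsIndecomposable 𝒱) :
    ∃ a : F, ∀ k, ∀ l ∈ weights 𝒱 (rep F V) k, l X = a + k := by
  have hψ := hq.isGradedRep
  obtain ⟨deg, hdeg⟩ := exists_linearMap_of_isInternal hq.isInternal fun k =>
    (k : F) • (𝒱 k).subtype
  replace hdeg : ∀ k, ∀ v ∈ 𝒱 k, deg v = (k : F) • v := hdeg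
  obtain ⟨a, ha⟩ := exists_forall_eigenvalue_eq hq hindec (rep F V 0 X - deg)
    (fun k v hv => by
      rw [LinearMap.sub_apply, hdeg k v hv]
      exact (𝒱 k).sub_mem (hψ.mem_zero X hv) ((𝒱 k).smul_mem _ hv))
    (fun x v => by
      let T : Module.End F V := rep F V 0 X - deg
      let φ : W F →ₗ[F] Module.End F V := (LieModule.toEnd F (W F) V : W F →ₗ[F] Module.End F V)
      have key : ∀ α f, T ∘ₗ φ (W.tf α f) = φ (W.tf α f) ∘ₗ T := by
        intro α f
        refine linearMap_eq_of_isInternal hq.isInternal fun k v hv => ?_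
        change rep F V 0 X (rep F V α f v) - deg (rep F V α f v) =
          rep F V α f (rep F V 0 X v - deg v)
        rw [hdeg k v hv, hdeg _ _ (hψ.mem α f k v hv), hψ.zero_comp, map_sub, map_smul, taylor_X,
          add_sub_cancel_left, ← smul_eq_C_mul, map_smul, LinearMap.smul_apply]
        push_cast
        module
      exact LinearMap.congr_fun (W.lie_eq_of_forall_tf
        (Φ := (LinearMap.mulLeft F T).comp φ) (Ψ := (LinearMap.mulRight F T).comp φ) key x) v)
  refine ⟨a, fun k l ⟨v, hv, hv0, hvl⟩ => ?_⟩
  rw [← ha v hv0 (l X - k) (by rw [LinearMap.sub_apply, hvl, hdeg k v hv, sub_smul])]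
  ring

theorem exists_forall_weight_apply_one [IsAlgClosed F] (hq : IsQuasifinite 𝒱)
    (hindec : IsIndecomposable 𝒱) :
    ∃ c : F, ∀ k, ∀ l ∈ weights 𝒱 (rep F V) k, l 1 = c := by
  have hψ := hq.isGradedRep
  obtain ⟨c, hc⟩ := exists_forall_eigenvalue_eq hq hindec (rep F V 0 1)
    (fun k v hv => hψ.mem_zero 1 hv)
    (fun x v => by
      rw [rep_apply, rep_apply, leibniz_lie, W.lie_def]
      change ⁅(1 : W F) * x - x * 1, v⁆ + _ = _
      rw [one_mul, mul_one, sub_self, zero_lie, zero_add])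
  exact ⟨c, fun k l ⟨v, _, hv0, hvl⟩ => hc v hv0 _ (hvl 1)⟩

/-- `l X = a + k` and `l = 0` leave a single nonzero degree. There all `t^α f(D)` with `α ≠ 0` act
by zero, and commutators of degrees `±1` then make the degree-zero action shift-invariant, hence
zero. -/
theorem hasTrivialCompositionFactor_of_weights_eq_zero [IsAlgClosed F] [CharZero F] [Nontrivial V]
    (hq : IsQuasifinite 𝒱) {a : F} (ha : ∀ k, ∀ l ∈ weights 𝒱 (rep F V) k, l X = a + k)
    (h0 : ∀ k, ∀ l ∈ weights 𝒱 (rep F V) k, l = 0) : HasTrivialCompositionFactor 𝒱 := by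
  have hψ := hq.isGradedRep
  have := hq.finiteDimensional
  have hne : ∀ k, 𝒱 k ≠ ⊥ → a + k = 0 := by
    intro k hk
    obtain ⟨l, hl⟩ := hψ.exists_weight_of_le (𝒱 k) le_rfl hk fun g v hv => hψ.mem_zero g hv
    rw [← ha k l hl, h0 k l hl, LinearMap.zero_apply]
  obtain ⟨k, hk⟩ := exists_ne_bot_of_isInternal hq.isInternal
  have hbot : ∀ j, j ≠ k → 𝒱 j = ⊥ := by
    intro j hj
    by_contra h
    have : (j : F) = k := add_left_cancel ((hne j h).trans (hne k hk).symm)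
    exact hj (by exact_mod_cast this)
  obtain ⟨v, hv, hv0⟩ := (Submodule.ne_bot_iff _).mp hk
  have hα : ∀ α : ℤ, α ≠ 0 → ∀ f, rep F V α f v = 0 := by
    intro α hα f
    have := hψ.mem α f k v hv
    rwa [hbot _ (by omega), Submodule.mem_bot] at this
  have hzero : (rep F V 0 : F[X] →ₗ[F] V →ₗ[F] V).flip v = 0 := by
    refine eq_zero_of_forall_taylor (one_ne_zero (α := F)) fun g => ?_
    have := hψ.eq_taylor_of_apply_eq_zero (α := 1) (hα 1 one_ne_zero 1) (hα (-1) (by norm_num) g)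
    simpa using this
  refine hasTrivialCompositionFactor_of_lie_eq_zero hv hv0 fun x => ?_
  refine W.lie_eq_of_forall_tf (Φ := (LieModule.toEnd F (W F) V : W F →ₗ[F] V →ₗ[F] V).flip v)
    (Ψ := 0) (fun α f => ?_) x
  by_cases h : α = 0
  · subst h
    exact LinearMap.congr_fun hzero f
  · exact hα α h f

theorem exists_gradedIso_aMod [IsAlgClosed F] [CharZero F] [Nontrivial V]
    (hq : IsQuasifinite 𝒱) {a : F} (hw : ∀ k, ∀ l ∈ weights 𝒱 (rep F V) k, l = leval (a + k)) :
    ∃ (p : ℕ) (G : Matrix (Fin p) (Fin p) F), 1 ≤ p ∧ GradedIso 𝒱 (AMod.grade G) := by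
  obtain ⟨p, G, e, hp, he, hgr⟩ := hq.isGradedRep.exists_equiv_actA hq.isInternal
    hq.finiteDimensional hw
  refine ⟨p, G, hp, { (e : V ≃ₗ[F] AMod G) with map_lie' := fun {x v} => ?_ }, hgr⟩
  exact W.lie_eq_of_forall_tf
    (Φ := e.toLinearMap.comp ((LieModule.toEnd F (W F) V : W F →ₗ[F] V →ₗ[F] V).flip v))
    (Ψ := (actA G).flip (e v)) (fun α f => he α f v) x

theorem exists_gradedIso_aBarMod [IsAlgClosed F] [CharZero F] [Nontrivial V]
    (hq : IsQuasifinite 𝒱) {a : F}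
    (hw : ∀ k, ∀ l ∈ weights 𝒱 (rep F V) k, l = -leval (-a - k)) :
    ∃ (p : ℕ) (G : Matrix (Fin p) (Fin p) F), 1 ≤ p ∧ GradedIso 𝒱 (ABarMod.grade G) := by
  have hw' : ∀ k, ∀ l ∈ weights 𝒱 (twist (rep F V)) k, l = leval (a + k) := by
    intro k l hl
    have h1 := hw k _ (weights_twist hl)
    rw [neg_inj] at h1
    refine LinearMap.ext fun g => ?_
    have h2 := LinearMap.congr_fun h1 (reflect 0 g)
    rw [LinearMap.comp_apply, reflect_reflect, leval_apply, eval_reflect] at h2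
    rw [h2, leval_apply]
    congr 1
    push_cast
    ring
  obtain ⟨p, G, e, hp, he, hgr⟩ := hq.isGradedRep.twist.exists_equiv_actA hq.isInternal
    hq.finiteDimensional hw'
  refine ⟨p, G, hp, { (e : V ≃ₗ[F] ABarMod G) with map_lie' := fun {x v} => ?_ }, hgr⟩
  refine W.lie_eq_of_forall_tf
    (Φ := e.toLinearMap.comp ((LieModule.toEnd F (W F) V : W F →ₗ[F] V →ₗ[F] V).flip v))
    (Ψ := (actB G).flip (e v)) (fun α f => ?_) x
  have h1 := he α (reflect α f) v
  rw [twist_apply, reflect_reflect, map_neg] at h1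
  change e (rep F V α f v) = actB G (W.tf α f) (e v)
  rw [actB_eq_neg_actA, ← h1, neg_neg]

theorem exists_gradedIso_aMod_or_aBarMod [IsAlgClosed F] [CharZero F]
    (hbounded : IsUniformlyBounded 𝒱) (hindec : IsIndecomposable 𝒱)
    (hnontriv : ¬ HasTrivialCompositionFactor 𝒱) :
    ∃ (p : ℕ) (G : Matrix (Fin p) (Fin p) F), 1 ≤ p ∧
      (GradedIso 𝒱 (AMod.grade G) ∨ GradedIso 𝒱 (ABarMod.grade G)) := by
  have hq := hbounded.toIsQuasifinite
  have hψ := hq.isGradedRep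
  have hfin := hq.finiteDimensional
  have := hindec.nontrivial
  obtain ⟨N, -, hN⟩ := hbounded.bounded
  obtain ⟨a, ha⟩ := exists_forall_weight_apply_X hq hindec
  obtain ⟨c, hc⟩ := exists_forall_weight_apply_one hq hindec
  -- The value at `1` separates the three types of weight, and the value at `X` fixes the evaluation
  -- point. As `c` is common to all weights, the type is too.
  have hlev : ∀ k, ∀ l ∈ weights 𝒱 (rep F V) k,
      l = 0 ∧ c = 0 ∨ l = leval (a + k) ∧ c = 1 ∨ l = -leval (-a - k) ∧ c = -1 := by
    intro k l hl
    rw [← hc k l hl]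
    have hX := ha k l hl
    rcases hψ.weights_eq_leval hfin hN hl with rfl | ⟨x, rfl | rfl⟩
    · simp
    · rw [leval_apply, eval_X] at hX
      subst hX
      simp
    · rw [LinearMap.neg_apply, leval_apply, eval_X] at hX
      have : x = -a - k := by linear_combination -hX
      subst this
      simp
  have h1 : (1 : F) ≠ -1 := fun h => two_ne_zero (α := F) (by linear_combination h)
  have h2 : (-1 : F) ≠ 0 := neg_ne_zero.mpr one_ne_zero
  obtain ⟨k, hk⟩ := exists_ne_bot_of_isInternal hq.isInternal
  obtain ⟨l, hl⟩ := hψ.exists_weight_of_le (𝒱 k) le_rfl hk fun g v hv => hψ.mem_zero g hv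
  rcases hlev k l hl with ⟨-, rfl⟩ | ⟨-, rfl⟩ | ⟨-, rfl⟩
  · refine absurd (hasTrivialCompositionFactor_of_weights_eq_zero hq ha fun k l hl => ?_) hnontriv
    rcases hlev k l hl with h | h | h
    · exact h.1
    · exact absurd h.2 zero_ne_one
    · exact absurd h.2.symm h2
  · obtain ⟨p, G, hp, h⟩ := exists_gradedIso_aMod hq (a := a) fun k l hl => by
      rcases hlev k l hl with h | h | h
      · exact absurd h.2 one_ne_zero
      · exact h.1
      · exact absurd h.2 h1
    exact ⟨p, G, hp, Or.inl h⟩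
  · obtain ⟨p, G, hp, h⟩ := exists_gradedIso_aBarMod hq (a := a) fun k l hl => by
      rcases hlev k l hl with h | h | h
      · exact absurd h.2 h2
      · exact absurd h.2.symm h1
      · exact h.1
    exact ⟨p, G, hp, Or.inr h⟩

end Classification

end WeylType

theorem proposition2p2 {F : Type*} [Field F] [IsAlgClosed F] [CharZero F]
    {V : Type*} [AddCommGroup V] [Module F V] [LieRingModule (WeylType.W F) V]
    [LieModule F (WeylType.W F) V] (𝒱 : ℤ → Submodule F V)
    (hbounded : WeylType.IsUniformlyBounded 𝒱)
    (hindec : WeylType.IsIndecomposable 𝒱)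
    (hnontriv : ¬ WeylType.HasTrivialCompositionFactor 𝒱) :
    ∃ (p : ℕ) (G : Matrix (Fin p) (Fin p) F), 1 ≤ p ∧
      (WeylType.GradedIso 𝒱 (WeylType.AMod.grade G) ∨
        WeylType.GradedIso 𝒱 (WeylType.ABarMod.grade G)) :=
  WeylType.exists_gradedIso_aMod_or_aBarMod hbounded hindec hnontriv
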